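/- Let $X$ and $A$ be finite sets. Write $M_A$ for the algebra of complex matrices over $A\times A$ with matrix units $\epsilon_{a,a'}$, $\mathcal D_X\subseteq M_X$ for the diagonal matrices, $M_{AA}=M_A\otimes M_A$, $\mathcal D_{XX}=\mathcal D_X\otimes\mathcal D_X$, $\mathcal P_{AA}$ for the projection lattice of $M_{AA}$ and $\mathcal P^{\rm cl}_{XX}$ for the projection lattice of $\mathcal D_{XX}$. Let $\mathcal B_{X,A}=M_A\ast_1\cdots\ast_1M_A$ be the C*-algebraic free product, amalgamated over the units, of copies of $M_A$ indexed by $X$, and let $e_{x,a,a'}$ be the matrix units of its $x$-th copy. Set $$E_{\rm cq}=\sum_{x,a,a'}\epsilon_{x,x}\otimes\epsilon_{a,a'}\otimes e_{x,a,a'}\in\mathcal D_X\otimes M_A\otimes\mathcal B_{X,A},\qquad E_{\rm cq}^{\rm op}=\sum_{x,a,a'}\epsilon_{x,x}\otimes\epsilon_{a,a'}\otimes e_{x,a',a}^{\rm op}\in\mathcal D_X\otimes M_A\otimes\mathcal B_{X,A}^{\rm op},$$ and, for $P\in\mathcal P^{\rm cl}_{XX}$ and $Q\in\mathcal P_{AA}$,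 let $\beta_{P,Q}:\mathcal D_{XX}\otimes M_{AA}\otimes\mathcal B_{X,A}\otimes\mathcal B_{X,A}^{\rm op}\to\mathcal B_{X,A}$ be the linear map with $\beta_{P,Q}(\omega\otimes u\otimes v^{\rm op})={\rm Tr}(\omega(P\otimes Q))\,uv$ (algebraic tensor products; $E_{\rm cq}\otimes E_{\rm cq}^{\rm op}$ is regarded as an element of the domain by reordering tensor factors). A *concurrent classical-to-quantum game* is a map $\varphi:\mathcal P^{\rm cl}_{XX}\to\mathcal P_{AA}$ that preserves joins and satisfies $\varphi(0)=0$ and $$\varphi\Big(\sum_{x\in X}\epsilon_{x,x}\otimes\epsilon_{x,x}\Big)=\frac1{|A|}\sum_{a,a'\in A}\epsilon_{a,a'}\otimes\epsilon_{a,a'}.$$ A *CQNS correlation* is a completely positive trace-preserving map $\Gamma:\mathcal D_{XX}\to M_{AA}$ such that, for $\rho,\sigma\in\mathcal D_X$, the partial trace of $\Gamma(\rho\otimes\sigma)$ over the first (resp. second) tensor factor vanishes whenever ${\rm Tr}(\rho)=0$ (resp. ${\rm Tr}(\sigma)=0$). It is a *perfect strategy* for $\varphi$ if ${\rm Tr}(\Gamma(P)\varphi(P)^\perp)=0$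 for all $P\in\mathcal P^{\rm cl}_{XX}$, where $Q^\perp=I-Q$. A *semi-classical stochastic operator matrix* on a Hilbert space $H$ is a family $(E_{x,a,a'})_{x\in X;\,a,a'\in A}$ in $\mathcal B(H)$ such that, for every $x\in X$, the block operator matrix $(E_{x,a,a'})_{a,a'}$ is positive and $\sum_{a}E_{x,a,a}=I$. The correlation $\Gamma$ is *quantum commuting* if there are a Hilbert space $H$, a unit vector $\xi\in H$ and semi-classical stochastic operator matrices $(E_{x,a,a'})$ and $(F_{y,b,b'})$ on $H$ such that every $E_{x,a,a'}$ commutes with every $F_{y,b,b'}$ and $$\Gamma(\epsilon_{x,x}\otimes\epsilon_{y,y})=\sum_{a,a',b,b'}\langle E_{x,a,a'}F_{y,b,b'}\xi,\xi\rangle\,\epsilon_{a,a'}\otimes\epsilon_{b,b'},\qquad x,y\in X.$$ It is *quantum* if there are finite-dimensional Hilbert spaces $H,K$, a unit vector $\xi\in H\otimes K$ and semi-classical stochastic operator matrices $(E_{x,a,a'})$ on $H$ and $(F_{y,b,b'})$ on $K$ such that the same formula holds with $E_{x,a,a'}\otimes F_{y,b,b'}$ in place of $E_{x,a,a'}F_{y,b,b'}$.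 **Statement.** Let $\varphi$ be a concurrent classical-to-quantum game and let $\Gamma:\mathcal D_{XX}\to M_{AA}$ be a CQNS correlation. The following are equivalent: (i) $\Gamma$ is quantum commuting (resp. quantum) and is a perfect strategy for $\varphi$; (ii) there exists a tracial state $\tau$ on $\mathcal B_{X,A}$ (resp. a tracial state $\tau$ on $\mathcal B_{X,A}$ that factors through a finite-dimensional unital *-representation $\pi$ of $\mathcal B_{X,A}$, i.e. $\tau=\sigma\circ\pi$ for a tracial state $\sigma$ on $\pi(\mathcal B_{X,A})$) such that $$\Gamma(\epsilon_{x,x}\otimes\epsilon_{y,y})=\sum_{a,a',b,b'}\tau(e_{x,a,a'}e_{y,b',b})\,\epsilon_{a,a'}\otimes\epsilon_{b,b'},\qquad x,y\in X,$$ and $$\tau\big(\beta_{P,\varphi(P)^\perp}(E_{\rm cq}\otimes E_{\rm cq}^{\rm op})\big)=0\qquad\text{for all }P\in\mathcal P^{\rm cl}_{XX}.$$ -/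

import Mathlib

open scoped Matrix Kronecker TensorProduct ComplexOrder MatrixOrder ENNReal

universe u

namespace CqGame

noncomputable section

/-! ### Diagonal matrices, projections, partial traces -/

/-- `D_I`: the *-algebra of diagonal complex matrices indexed by `I × I`. -/
def Diag (I : Type u) [Fintype I] [DecidableEq I] : StarSubalgebra ℂ (Matrix I I ℂ) where
  carrier := {M | M.IsDiag}
  mul_mem' {M N} hM hN := by
    rw [Set.mem_ofPred_eq] at hM hN ⊢
    rw [← hM.diagonal_diag, ← hN.diagonal_diag, Matrix.diagonal_mul_diagonal]
    exact Matrix.isDiag_diagonal _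
  add_mem' hM hN := Matrix.IsDiag.add hM hN
  algebraMap_mem' r := by
    rw [Set.mem_ofPred_eq, Matrix.algebraMap_eq_diagonal]
    exact Matrix.isDiag_diagonal _
  star_mem' hM := Matrix.IsDiag.conjTranspose hM

/-- The diagonal matrix unit `ε_{x,x}`, as an element of `D_X`. -/
def diagUnit {X : Type u} [Fintype X] [DecidableEq X] (x : X) : Diag X :=
  ⟨Matrix.single x x 1, show (Matrix.single x x (1 : ℂ)).IsDiag from fun _ _ hij =>
    Matrix.single_apply_of_ne _ _ _ _ _ fun h => hij (h.1.symm.trans h.2)⟩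

/-- The tensor product `D_X × D_Y → D_{XY}`, `(ρ, σ) ↦ ρ ⊗ σ`, as a bilinear map. -/
def diagKron {X Y : Type u} [Fintype X] [DecidableEq X] [Fintype Y] [DecidableEq Y] :
    Diag X →ₗ[ℂ] Diag Y →ₗ[ℂ] Diag (X × Y) :=
  LinearMap.mk₂ ℂ (fun ρ σ => ⟨(ρ : Matrix X X ℂ) ⊗ₖ (σ : Matrix Y Y ℂ),
      Matrix.IsDiag.kronecker ρ.2 σ.2⟩)
    (fun _ _ _ => Subtype.ext (Matrix.add_kronecker _ _ _))
    (fun _ _ _ => Subtype.ext (Matrix.smul_kronecker _ _ _))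
    (fun _ _ _ => Subtype.ext (Matrix.kronecker_add _ _ _))
    (fun _ _ _ => Subtype.ext (Matrix.kronecker_smul _ _ _))

/-- The tensor product `M_A × M_B → M_{AB}`, `(S, T) ↦ S ⊗ T`, as a bilinear map. -/
def matKron {A B : Type u} [Fintype A] [DecidableEq A] [Fintype B] [DecidableEq B] :
    Matrix A A ℂ →ₗ[ℂ] Matrix B B ℂ →ₗ[ℂ] Matrix (A × B) (A × B) ℂ :=
  LinearMap.mk₂ ℂ (fun S T => S ⊗ₖ T)
    Matrix.add_kronecker Matrix.smul_kronecker Matrix.kronecker_add Matrix.kronecker_smul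

/-- The projections in `M_I`, with the usual (Loewner) order of self-adjoint matrices. -/
abbrev Proj (I : Type u) [Fintype I] [DecidableEq I] :=
  {P : Matrix I I ℂ // IsStarProjection P}

/-- The classical projections, that is, those in `D_I`, with the usual order. -/
abbrev ClProj (I : Type u) [Fintype I] [DecidableEq I] :=
  {P : Diag I // IsStarProjection P}

/-- The partial trace `Tr_A : M_{AB} → M_B`. -/
def traceFst {A B : Type u} [Fintype A] (M : Matrix (A × B) (A × B) ℂ) : Matrix B B ℂ :=
  Matrix.of fun b b' => ∑ a, M (a, b) (a, b')

/-- The partial trace `Tr_B : M_{AB} → M_A`. -/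
def traceSnd {A B : Type u} [Fintype B] (M : Matrix (A × B) (A × B) ℂ) : Matrix A A ℂ :=
  Matrix.of fun a a' => ∑ b, M (a, b) (a', b)

/-! ### Classical-to-quantum games -/

/-- A classical-to-quantum non-local game: a join-preserving map `φ : P_{XY}^{cl} → P_{AB}`
with `φ(0) = 0`. (`R` is the join of `P` and `Q` iff it is the least upper bound of `{P, Q}`.) -/
structure Game (X Y A B : Type u) [Fintype X] [DecidableEq X] [Fintype Y] [DecidableEq Y]
    [Fintype A] [DecidableEq A] [Fintype B] [DecidableEq B] where
  toFun : ClProj (X × Y) → Proj (A × B)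
  map_zero : toFun ⟨0, IsStarProjection.zero _⟩ = ⟨0, IsStarProjection.zero _⟩
  map_join : ∀ P Q R : ClProj (X × Y), IsLUB {P, Q} R → IsLUB {toFun P, toFun Q} (toFun R)

/-- `J_A = |A|⁻¹ ∑_{a,a'} ε_{a,a'} ⊗ ε_{a,a'}`. -/
def maxEnt (A : Type u) [Fintype A] [DecidableEq A] : Matrix (A × A) (A × A) ℂ :=
  (Fintype.card A : ℂ)⁻¹ •
    ∑ a : A, ∑ a' : A, Matrix.single a a' (1 : ℂ) ⊗ₖ Matrix.single a a' (1 : ℂ)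

/-- `J_X^{cl} = ∑_x ε_{x,x} ⊗ ε_{x,x}`. -/
def maxEntCl (X : Type u) [Fintype X] [DecidableEq X] : Diag (X × X) :=
  ∑ x : X, diagKron (diagUnit x) (diagUnit x)

lemma isStarProjection_maxEntCl (X : Type u) [Fintype X] [DecidableEq X] :
    IsStarProjection (maxEntCl X) := by
  have h : ((maxEntCl X : Diag (X × X)) : Matrix (X × X) (X × X) ℂ) =
      Matrix.diagonal fun p => if p.1 = p.2 then 1 else 0 := by
    unfold maxEntCl diagKron diagUnit
    rw [AddSubmonoidClass.coe_finsetSum]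
    ext ⟨i, j⟩ ⟨k, l⟩
    simp only [Matrix.sum_apply, LinearMap.mk₂_apply, Matrix.kroneckerMap_apply,
      Matrix.single_apply, Matrix.diagonal_apply, Prod.mk.injEq]
    by_cases h : i = k ∧ j = l
    · obtain ⟨rfl, rfl⟩ := h
      simp only [and_self, if_true, mul_ite, mul_one, mul_zero]
      rw [Finset.sum_eq_single i]
      · simp
      · intro b _ hb
        simp [hb]
      · simp
    · rw [if_neg h]
      refine Finset.sum_eq_zero fun x _ => ?_
      by_cases h1 : x = i ∧ x = k
      · have h2 : ¬ (x = j ∧ x = l) := by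
          rintro ⟨rfl, rfl⟩
          exact h ⟨h1.1.symm.trans h1.2, rfl⟩
        simp [h2]
      · simp [h1]
  constructor
  · refine Subtype.ext ?_
    change (maxEntCl X : Matrix (X × X) (X × X) ℂ) * (maxEntCl X : Matrix (X × X) (X × X) ℂ) = _
    rw [h, Matrix.diagonal_mul_diagonal]
    congr 1
    ext p
    split_ifs <;> simp
  · refine Subtype.ext ?_
    change star (maxEntCl X : Matrix (X × X) (X × X) ℂ) = _
    rw [h, Matrix.star_eq_conjTranspose, Matrix.diagonal_conjTranspose]
    congr 1
    ext p
    simp only [Pi.star_apply]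
    split_ifs <;> simp

/-- A game `φ : P_{XX}^{cl} → P_{AA}` is concurrent if `φ(J_X^{cl}) = J_A`. -/
def Game.IsConcurrent {X A : Type u} [Fintype X] [DecidableEq X] [Fintype A] [DecidableEq A]
    (φ : Game X X A A) : Prop :=
  (φ.toFun ⟨maxEntCl X, isStarProjection_maxEntCl X⟩ : Matrix (A × A) (A × A) ℂ) = maxEnt A

/-! ### Classical-to-quantum no-signalling correlations -/

section Correlations

variable {X Y A B : Type u} [Fintype X] [DecidableEq X] [Fintype Y] [DecidableEq Y]
  [Fintype A] [DecidableEq A] [Fintype B] [DecidableEq B]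

/-- A quantum channel `D_I → M_J`: a completely positive trace-preserving map. Elements of
`M_n(D_I)` and of `M_n(M_J)` are block matrices, flattened by `Matrix.comp`. -/
def IsChannel {I J : Type u} [Fintype I] [DecidableEq I] [Fintype J] [DecidableEq J]
    (Γ : Diag I →ₗ[ℂ] Matrix J J ℂ) : Prop :=
  (∀ (n : ℕ) (T : Matrix (Fin n) (Fin n) (Diag I)),
    (Matrix.comp (Fin n) (Fin n) I I ℂ (T.map fun d => (d : Matrix I I ℂ))).PosSemidef →
    (Matrix.comp (Fin n) (Fin n) J J ℂ (T.map Γ)).PosSemidef) ∧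
  ∀ ω : Diag I, (Γ ω).trace = (ω : Matrix I I ℂ).trace

/-- Classical-to-quantum no-signalling (CQNS) correlations `D_{XY} → M_{AB}`. -/
def IsCQNS (Γ : Diag (X × Y) →ₗ[ℂ] Matrix (A × B) (A × B) ℂ) : Prop :=
  IsChannel Γ ∧
  (∀ (ρ : Diag X) (σ : Diag Y), (ρ : Matrix X X ℂ).trace = 0 → traceFst (Γ (diagKron ρ σ)) = 0) ∧
  (∀ (ρ : Diag X) (σ : Diag Y), (σ : Matrix Y Y ℂ).trace = 0 → traceSnd (Γ (diagKron ρ σ)) = 0)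

/-- Semi-classical stochastic operator matrices `(E_{x,a,a'})` acting on a Hilbert space `H`:
every block operator matrix `(E_{x,a,a'})_{a,a'}` is a positive operator on `⊕_{a ∈ A} H`, and
`∑_a E_{x,a,a} = I` for every `x`. -/
def IsStochastic {H : Type u} [NormedAddCommGroup H] [InnerProductSpace ℂ H]
    (E : X → A → A → (H →L[ℂ] H)) : Prop :=
  (∀ (x : X) (v : A → H), 0 ≤ ∑ a, ∑ a', inner ℂ (v a) (E x a a' (v a'))) ∧
  ∀ x, ∑ a, E x a a = 1

/-- Quantum commuting: the Choi matrix of `Γ` is given by `⟨E_{x,a,a'} F_{y,b,b'} ξ, ξ⟩` for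
commuting semi-classical stochastic operator matrices on a Hilbert space and a unit vector `ξ`. -/
def IsQuantumCommuting (Γ : Diag (X × Y) →ₗ[ℂ] Matrix (A × B) (A × B) ℂ) : Prop :=
  ∃ (H : Type u) (_ : NormedAddCommGroup H) (_ : InnerProductSpace ℂ H) (_ : CompleteSpace H)
    (ξ : H) (E : X → A → A → (H →L[ℂ] H)) (F : Y → B → B → (H →L[ℂ] H)),
    ‖ξ‖ = 1 ∧ IsStochastic E ∧ IsStochastic F ∧
    (∀ x a a' y b b', E x a a' * F y b b' = F y b b' * E x a a') ∧
    ∀ x y a a' b b', Γ (diagKron (diagUnit x) (diagUnit y)) (a, b) (a', b') =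
      inner ℂ ξ ((E x a a' * F y b b') ξ)

/-- Quantum: the same with `E_{x,a,a'} ⊗ F_{y,b,b'}`, acting on a tensor product of
finite-dimensional Hilbert spaces. -/
def IsQuantum (Γ : Diag (X × Y) →ₗ[ℂ] Matrix (A × B) (A × B) ℂ) : Prop :=
  ∃ (H K : Type u) (_ : NormedAddCommGroup H) (_ : InnerProductSpace ℂ H)
    (_ : FiniteDimensional ℂ H) (_ : NormedAddCommGroup K) (_ : InnerProductSpace ℂ K)
    (_ : FiniteDimensional ℂ K) (ξ : H ⊗[ℂ] K)
    (E : X → A → A → (H →L[ℂ] H)) (F : Y → B → B → (K →L[ℂ] K)),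
    ‖ξ‖ = 1 ∧ IsStochastic E ∧ IsStochastic F ∧
    ∀ x y a a' b b', Γ (diagKron (diagUnit x) (diagUnit y)) (a, b) (a', b') =
      inner ℂ ξ (TensorProduct.map (E x a a' : H →ₗ[ℂ] H) (F y b b' : K →ₗ[ℂ] K) ξ)

/-- `Γ` is a perfect strategy for `φ` if `⟨Γ(P), φ(P)_⊥⟩ = 0` for every classical projection `P`.
Here `Q_⊥` is the projection onto the annihilator of the range of `Q`, i.e. the dual operator
`(I - Q)ᵈ`, and the duality is `⟨ρ, ωᵈ⟩ = Tr(ρ ω)`. -/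
def IsPerfect (φ : Game X Y A B) (Γ : Diag (X × Y) →ₗ[ℂ] Matrix (A × B) (A × B) ℂ) : Prop :=
  ∀ P : ClProj (X × Y), (Γ P * (1 - (φ.toFun P : Matrix (A × B) (A × B) ℂ))).trace = 0

end Correlations

/-! ### The free product C*-algebra `M_A *₁ ⋯ *₁ M_A` -/

/-- A nonzero unital C*-algebra `C` together with a family, indexed by `X`, of unital
*-homomorphisms `M_A → C`. -/
structure Rep (X A : Type u) [Fintype A] [DecidableEq A] : Type (u + 1) where
  C : Type u
  [cstar : CStarAlgebra C]
  [nontriv : Nontrivial C]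
  hom : X → (Matrix A A ℂ →⋆ₐ[ℂ] C)

attribute [instance] Rep.cstar Rep.nontriv

section FreeProduct

variable (X A : Type u) [Fintype A] [DecidableEq A]

/-- The C*-algebra of all bounded families `(c_ρ)_ρ`, `c_ρ ∈ C_ρ`, over all `ρ : Rep X A`. -/
abbrev BoundedFamilies := lp (fun ρ : Rep X A => ρ.C) ∞

instance : CStarAlgebra (BoundedFamilies X A) where

variable {X A}

open scoped Matrix.Norms.L2Operator in
lemma memℓp_hom (x : X) (T : Matrix A A ℂ) :
    Memℓp (fun ρ : Rep X A => ρ.hom x T) ∞ := by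
  refine memℓp_infty ⟨‖T‖, ?_⟩
  rintro _ ⟨ρ, rfl⟩
  exact NonUnitalStarAlgHom.norm_apply_le (ρ.hom x) T

/-- The family `(ρ_x(T))_ρ`. -/
def genFamily (x : X) (T : Matrix A A ℂ) : BoundedFamilies X A :=
  ⟨fun ρ => ρ.hom x T, memℓp_hom x T⟩

variable (X A)

/-- The universal free product C*-algebra `B_{X,A} = M_A *₁ ⋯ *₁ M_A` (`|X|` terms, amalgamated over
the units): the C*-algebra generated by the copies of `M_A` inside the product of all families of
unital *-homomorphisms `(M_A → C)_{x ∈ X}` into C*-algebras. (It is enough to let `C` range over one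
universe, since `C` can be replaced by the separable C*-subalgebra generated by the copies of
`M_A`.) -/
def FreeProd : Type (u + 1) :=
  (StarAlgebra.adjoin ℂ {g : BoundedFamilies X A |
    ∃ (x : X) (T : Matrix A A ℂ), g = genFamily x T}).topologicalClosure

instance : CStarAlgebra (FreeProd X A) :=
  haveI := StarSubalgebra.isClosed_topologicalClosure (StarAlgebra.adjoin ℂ
    {g : BoundedFamilies X A | ∃ (x : X) (T : Matrix A A ℂ), g = genFamily x T})
  inferInstanceAs (CStarAlgebra (StarAlgebra.adjoin ℂ {g : BoundedFamilies X A |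
    ∃ (x : X) (T : Matrix A A ℂ), g = genFamily x T}).topologicalClosure)

variable {X A}

/-- The canonical unital *-homomorphism of `M_A` onto the `x`-th copy of `M_A` in `B_{X,A}`. -/
def incl (x : X) : Matrix A A ℂ →⋆ₐ[ℂ] FreeProd X A where
  toFun T := ⟨genFamily x T, StarSubalgebra.le_topologicalClosure _
    (StarAlgebra.subset_adjoin ℂ _ ⟨x, T, rfl⟩)⟩
  map_one' := Subtype.ext <| lp.ext <| funext fun ρ => map_one (ρ.hom x)
  map_mul' S T := Subtype.ext <| lp.ext <| funext fun ρ => map_mul (ρ.hom x) S T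
  map_zero' := Subtype.ext <| lp.ext <| funext fun ρ => map_zero (ρ.hom x)
  map_add' S T := Subtype.ext <| lp.ext <| funext fun ρ => map_add (ρ.hom x) S T
  commutes' r := Subtype.ext <| lp.ext <| funext fun ρ => AlgHomClass.commutes (ρ.hom x) r
  map_star' T := Subtype.ext <| lp.ext <| funext fun ρ => map_star (ρ.hom x) T

/-- The matrix units `e_{x,a,a'}` of the `x`-th copy of `M_A` in `B_{X,A}`. -/
def gen (x : X) (a a' : A) : FreeProd X A := incl x (Matrix.single a a' 1)

/-- Evaluation at a given family; this is the universal property of `B_{X,A}`. -/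
def evalAt (ρ : Rep X A) : FreeProd X A →⋆ₐ[ℂ] ρ.C where
  toFun b := b.1 ρ
  map_one' := rfl
  map_mul' _ _ := rfl
  map_zero' := rfl
  map_add' _ _ := rfl
  commutes' _ := rfl
  map_star' _ := rfl

lemma evalAt_incl (ρ : Rep X A) (x : X) (T : Matrix A A ℂ) : evalAt ρ (incl x T) = ρ.hom x T := rfl

end FreeProduct

/-! ### Traces -/

/-- Tracial states on a unital *-algebra: positive unital linear functionals with
`τ(bc) = τ(cb)`. -/
structure IsTracialState {R : Type*} [Ring R] [StarRing R] [Algebra ℂ R] (τ : R →ₗ[ℂ] ℂ) :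
    Prop where
  nonneg : ∀ b, 0 ≤ τ (star b * b)
  map_one : τ 1 = 1
  map_mul_comm : ∀ b c, τ (b * c) = τ (c * b)

section Trace

variable {X A : Type u} [Fintype X] [DecidableEq X] [Fintype A] [DecidableEq A]

/-- `τ` factors through a finite-dimensional *-representation `π : B_{X,A} → B(H)`: it is of the
form `σ ∘ π` for a tracial state `σ` on `π(B_{X,A})`. -/
def FactorsFinDim (τ : FreeProd X A →ₗ[ℂ] ℂ) : Prop :=
  ∃ (H : Type u) (_ : NormedAddCommGroup H) (_ : InnerProductSpace ℂ H) (_ : CompleteSpace H)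
    (_ : FiniteDimensional ℂ H) (π : FreeProd X A →⋆ₐ[ℂ] (H →L[ℂ] H)) (σ : π.range →ₗ[ℂ] ℂ),
    IsTracialState σ ∧ ∀ b, τ b = σ (π.rangeRestrict b)

/-- `Γ(ε_{x,x} ⊗ ε_{y,y}) = (τ(e_{x,a,a'} e_{y,b',b}))_{a,a',b,b'}` for all `x, y`. -/
def IsGivenBy (Γ : Diag (X × X) →ₗ[ℂ] Matrix (A × A) (A × A) ℂ)
    (τ : FreeProd X A →ₗ[ℂ] ℂ) : Prop :=
  ∀ x y a a' b b', Γ (diagKron (diagUnit x) (diagUnit y)) (a, b) (a', b') =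
    τ (gen x a a' * gen y b' b)

variable (X A) in
/-- `E_cq = (e_{x,a,a'})_{x,a,a'} ∈ D_X ⊗ M_A ⊗ B_{X,A}`. -/
def Ecq : (Diag X ⊗[ℂ] Matrix A A ℂ) ⊗[ℂ] FreeProd X A :=
  ∑ x : X, ∑ a : A, ∑ a' : A,
    (diagUnit x ⊗ₜ[ℂ] Matrix.single a a' (1 : ℂ)) ⊗ₜ[ℂ] gen x a a'

variable (X A) in
/-- `E_cq^op = (e_{x,a',a}^op)_{x,a,a'} ∈ D_X ⊗ M_A ⊗ B_{X,A}^op`. -/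
def EcqOp : (Diag X ⊗[ℂ] Matrix A A ℂ) ⊗[ℂ] (FreeProd X A)ᵐᵒᵖ :=
  ∑ x : X, ∑ a : A, ∑ a' : A,
    (diagUnit x ⊗ₜ[ℂ] Matrix.single a a' (1 : ℂ)) ⊗ₜ[ℂ] MulOpposite.op (gen x a' a)

variable (X A) in
/-- The identification (shuffle of tensor factors)
`(D_X ⊗ M_A ⊗ B) ⊗ (D_X ⊗ M_A ⊗ B^op) → (D_{XX} ⊗ M_{AA}) ⊗ (B ⊗ B^op)`. -/
def shuffle :
    ((Diag X ⊗[ℂ] Matrix A A ℂ) ⊗[ℂ] FreeProd X A) ⊗[ℂ]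
      ((Diag X ⊗[ℂ] Matrix A A ℂ) ⊗[ℂ] (FreeProd X A)ᵐᵒᵖ) →ₗ[ℂ]
    (Diag (X × X) ⊗[ℂ] Matrix (A × A) (A × A) ℂ) ⊗[ℂ] (FreeProd X A ⊗[ℂ] (FreeProd X A)ᵐᵒᵖ) :=
  TensorProduct.map
    (TensorProduct.map (TensorProduct.lift diagKron) (TensorProduct.lift matKron) ∘ₗ
      (TensorProduct.tensorTensorTensorComm ℂ (Diag X) (Matrix A A ℂ)
        (Diag X) (Matrix A A ℂ)).toLinearMap)
    LinearMap.id ∘ₗ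
  (TensorProduct.tensorTensorTensorComm ℂ (Diag X ⊗[ℂ] Matrix A A ℂ) (FreeProd X A)
    (Diag X ⊗[ℂ] Matrix A A ℂ) (FreeProd X A)ᵐᵒᵖ).toLinearMap

/-- `ω ↦ Tr(ω (P ⊗ Q))` on `D_{XX} ⊗ M_{AA}`. -/
def trAgainst (P : Diag (X × X)) (Q : Matrix (A × A) (A × A) ℂ) :
    Diag (X × X) ⊗[ℂ] Matrix (A × A) (A × A) ℂ →ₗ[ℂ] ℂ :=
  TensorProduct.lift (LinearMap.mk₂ ℂ
    (fun (ω₁ : Diag (X × X)) (ω₂ : Matrix (A × A) (A × A) ℂ) =>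
      (((ω₁ : Matrix (X × X) (X × X) ℂ) ⊗ₖ ω₂) * ((P : Matrix (X × X) (X × X) ℂ) ⊗ₖ Q)).trace)
    (fun _ _ _ => by simp [Matrix.add_kronecker, add_mul])
    (fun _ _ _ => by simp [Matrix.smul_kronecker])
    (fun _ _ _ => by simp [Matrix.kronecker_add, add_mul])
    (fun _ _ _ => by simp [Matrix.kronecker_smul]))

/-- `u ⊗ v^op ↦ u v` on `B_{X,A} ⊗ B_{X,A}^op`. -/
def mulOp : FreeProd X A ⊗[ℂ] (FreeProd X A)ᵐᵒᵖ →ₗ[ℂ] FreeProd X A :=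
  LinearMap.mul' ℂ (FreeProd X A) ∘ₗ
    TensorProduct.map LinearMap.id (MulOpposite.opLinearEquiv ℂ).symm.toLinearMap

/-- The linear map `β_{P,Q} : D_{XX} ⊗ M_{AA} ⊗ B_{X,A} ⊗ B_{X,A}^op → B_{X,A}`,
`β_{P,Q}(ω ⊗ u ⊗ v^op) = Tr(ω (P ⊗ Q)) u v`. -/
def β (P : Diag (X × X)) (Q : Matrix (A × A) (A × A) ℂ) :
    (Diag (X × X) ⊗[ℂ] Matrix (A × A) (A × A) ℂ) ⊗[ℂ] (FreeProd X A ⊗[ℂ] (FreeProd X A)ᵐᵒᵖ)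
      →ₗ[ℂ] FreeProd X A :=
  TensorProduct.lift ((LinearMap.lsmul ℂ (FreeProd X A)).compl₁₂ (trAgainst P Q) mulOp)

/-- `τ(β_{P,φ(P)^⊥}(E_cq ⊗ E_cq^op)) = 0` for every classical projection `P`. -/
def Annihilates (τ : FreeProd X A →ₗ[ℂ] ℂ) (φ : Game X X A A) : Prop :=
  ∀ P : ClProj (X × X),
    τ (β P.1 (1 - (φ.toFun P : Matrix (A × A) (A × A) ℂ)) (shuffle X A (Ecq X A ⊗ₜ[ℂ] EcqOp X A)))
      = 0

end Trace

end

end CqGame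

namespace CqGame

noncomputable section

/-! ### Positive block operator matrices -/

/-! If `Γ` is given by `τ`, then `τ(β_{P,Q}(E_cq ⊗ E_cq^op)) = Tr(Γ(P) Q)` for all `P` and `Q`
(`map_beta_shuffle`), so perfection and the vanishing condition on `τ` are the same equations. What
remains is to pass between strategies and tracial states.

From strategies to traces. Perfection at `J_X^cl`, together with concurrency and trace preservation,
says that the sum over `x, a, a'` of `⟨E_{x,a',a} ξ, F_{x,a,a'} ξ⟩` equals `|X| |A|`. The Schwarz
inequality `‖E_{a,c} u‖² ≤ ⟨E_{c,c} u, u⟩` shows that this is the largest possible value, so every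
estimate is an equality: `E_{x,a',a} ξ = F_{x,a,a'} ξ`, and Schwarz is sharp at `ξ`
(`IsStochastic.eq_of_sum_le`). Sharpness forces the `E_{x,a,a'}` to multiply like matrix units on
`ξ` (`apply_apply_of_norm_sq_eq`). Operators in the commutant of `E` carry these relations to the
closure `K` of the commutant applied to `ξ`; `E` leaves `K` invariant because `E` acts on `ξ` as `F`
does. Hence `E` restricted to `K` is a representation of the free product, without any dilation. Its
vector state at `ξ` is tracial, since generators acting on `ξ` can be traded for operators commuting
with the representation (`isTracialState_vectorFunctional`). If the original space is
finite-dimensional, so is `K`.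

From traces to strategies. For a general trace one takes the GNS space, with left multiplication as
`E` and index-reversed right multiplication as `F` (`exists_commuting_of_tracialState`). For a trace
factoring through a finite-dimensional representation on `H`, the trace on the image has a density
`r²` with `r` central in the image (`exists_central_sqrt_density`); the vector `∑ r b_i ⊗ b_i` with
the representation on one leg and its transpose on the other reproduces `τ`
(`inner_operatorVector`). -/

lemma _root_.LinearMap.IsPositive.apply_eq_zero_of_inner_self_eq_zero {V : Type*}
    [NormedAddCommGroup V] [InnerProductSpace ℂ V] {T : V →ₗ[ℂ] V} (hT : T.IsPositive) {v : V}
    (hv : inner ℂ v (T v) = 0) : T v = 0 := by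
  set w := T v with hw
  have hwv : inner ℂ v (T w) = inner ℂ w w := by rw [← hT.isSymmetric, ← hw]
  have key : ∀ t : ℝ, 0 ≤ -(2 * t * ‖w‖ ^ 2) + t ^ 2 * (inner ℂ w (T w)).re := by
    intro t
    have h := hT.re_inner_nonneg_right (v - (t : ℂ) • w)
    have e : inner ℂ (v - (t : ℂ) • w) (T (v - (t : ℂ) • w)) =
        ((-(2 * t * ‖w‖ ^ 2) : ℝ) : ℂ) + ((t ^ 2 : ℝ) : ℂ) * inner ℂ w (T w) := by
      simp only [map_sub, map_smul, inner_sub_left, inner_sub_right, inner_smul_left,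
        inner_smul_right, ← hw, hv, hwv, inner_self_eq_norm_sq_to_K, Complex.conj_ofReal,
        Complex.coe_algebraMap]
      push_cast
      ring
    rw [e] at h
    simpa only [RCLike.re_eq_complex_re, Complex.add_re, Complex.ofReal_re, Complex.re_ofReal_mul]
      using h
  have hc : 0 ≤ (inner ℂ w (T w)).re := hT.re_inner_nonneg_right w
  set c := (inner ℂ w (T w)).re
  -- For small `t` the linear term wins. This `t` makes the expression `-‖w‖⁴ (c + 2) / (c + 1)²`;
  -- the `+ 1` also covers `c = 0`.
  have h := key (‖w‖ ^ 2 / (c + 1))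
  by_contra hne
  have hpos : 0 < ‖w‖ ^ 2 := by positivity
  have e : -(2 * (‖w‖ ^ 2 / (c + 1)) * ‖w‖ ^ 2) + (‖w‖ ^ 2 / (c + 1)) ^ 2 * c
      = -((‖w‖ ^ 2) ^ 2 * (c + 2) / (c + 1) ^ 2) := by
    field_simp
    ring
  rw [e] at h
  have : 0 < (‖w‖ ^ 2) ^ 2 * (c + 2) / (c + 1) ^ 2 := by positivity
  linarith

section Block

variable {H : Type*} [NormedAddCommGroup H] [InnerProductSpace ℂ H]
  {A : Type*} [Fintype A]

/-- The operator on `⊕_{a ∈ A} H` given by a block operator matrix. -/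
def blockOp (E : A → A → (H →L[ℂ] H)) :
    PiLp 2 (fun _ : A => H) →ₗ[ℂ] PiLp 2 (fun _ : A => H) where
  toFun v := WithLp.toLp 2 fun a => ∑ a', E a a' (v a')
  map_add' v w := by
    ext a
    simp [Finset.sum_add_distrib]
  map_smul' c v := by
    ext a
    simp [Finset.smul_sum]

lemma blockOp_apply (E : A → A → (H →L[ℂ] H)) (v : PiLp 2 (fun _ : A => H)) (a : A) :
    blockOp E v a = ∑ a', E a a' (v a') := rfl

lemma blockOp_single [DecidableEq A] (E : A → A → (H →L[ℂ] H)) (a b : A) (u : H) :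
    blockOp E (WithLp.toLp 2 (Pi.single a u)) b = E b a u := by
  rw [blockOp_apply, Finset.sum_eq_single a]
  · simp
  · intro c _ hc
    simp [hc]
  · simp

lemma inner_toLp_single_left [DecidableEq A] (a : A) (u : H) (v : PiLp 2 (fun _ : A => H)) :
    inner ℂ (WithLp.toLp 2 (Pi.single a u) : PiLp 2 (fun _ : A => H)) v = inner ℂ u (v a) := by
  rw [PiLp.inner_apply, Finset.sum_eq_single a]
  · simp
  · intro c _ hc
    simp [hc]
  · simp

lemma isPositive_blockOp {E : A → A → (H →L[ℂ] H)}
    (hE : ∀ v : A → H, 0 ≤ ∑ a, ∑ a', inner ℂ (v a) (E a a' (v a'))) : (blockOp E).IsPositive := by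
  rw [LinearMap.isPositive_iff]
  have h : ∀ v, 0 ≤ inner ℂ v (blockOp E v) := fun v => by
    rw [PiLp.inner_apply]
    simp only [blockOp_apply, inner_sum]
    exact hE v
  have hs : (blockOp E).IsSymmetric := by
    rw [LinearMap.isSymmetric_iff_inner_map_self_real]
    intro v
    have hv := (h v).star_eq
    rw [RCLike.star_def, inner_conj_symm] at hv
    rw [inner_conj_symm, hv]
  exact ⟨hs, fun v => by rw [hs]; exact h v⟩

end Block

/-! ### The Schwarz inequality for stochastic operator matrices and its equality case. -/

section Stochastic

variable {X A : Type u} [Fintype A]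
  {H : Type u} [NormedAddCommGroup H] [InnerProductSpace ℂ H] {E : X → A → A → (H →L[ℂ] H)}

namespace IsStochastic

lemma isPositive (hE : IsStochastic E) (x : X) : (blockOp (E x)).IsPositive :=
  isPositive_blockOp (hE.1 x)

/-- Symmetry of the block operator, tested on vectors supported in a single coordinate. It is
phrased with inner products because `H` is not assumed complete here. -/
lemma inner_apply_right [DecidableEq A] (hE : IsStochastic E) (x : X) (a a' : A) (u w : H) :
    inner ℂ u (E x a a' w) = inner ℂ (E x a' a u) w := by
  have h := (hE.isPositive x).isSymmetric (WithLp.toLp 2 (Pi.single a u))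
    (WithLp.toLp 2 (Pi.single a' w))
  rw [inner_toLp_single_left, blockOp_single, ← inner_conj_symm, inner_toLp_single_left,
    blockOp_single, inner_conj_symm] at h
  exact h.symm

lemma re_inner_diag_nonneg [DecidableEq A] (hE : IsStochastic E) (x : X) (a : A) (u : H) :
    0 ≤ (inner ℂ u (E x a a u)).re := by
  have h := (hE.isPositive x).re_inner_nonneg_right (WithLp.toLp 2 (Pi.single a u))
  rwa [inner_toLp_single_left, blockOp_single] at h

lemma sum_re_inner_diag (hE : IsStochastic E) (x : X) (u : H) :
    ∑ a, (inner ℂ u (E x a a u)).re = ‖u‖ ^ 2 := by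
  have h : ∑ a, inner ℂ u (E x a a u) = inner ℂ u u := by
    rw [← inner_sum, ← _root_.sum_apply, hE.2 x, one_apply_eq_self]
  rw [← Complex.re_sum, h, inner_self_eq_norm_sq_to_K]
  norm_cast

lemma re_inner_diag_le [DecidableEq A] (hE : IsStochastic E) (x : X) (a : A) (u : H) :
    (inner ℂ u (E x a a u)).re ≤ ‖u‖ ^ 2 := by
  rw [← hE.sum_re_inner_diag x u]
  exact Finset.single_le_sum (f := fun a => (inner ℂ u (E x a a u)).re)
    (fun b _ => hE.re_inner_diag_nonneg x b u) (Finset.mem_univ a)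

/-- The test vector on which both the Schwarz inequality and its equality case rest. -/
lemma re_inner_blockOp_sub [DecidableEq A] (hE : IsStochastic E) (x : X) (a a' : A) (u : H) :
    (inner ℂ (WithLp.toLp 2 (Pi.single a' u) - WithLp.toLp 2 (Pi.single a (E x a a' u)) :
        PiLp 2 (fun _ : A => H))
      (blockOp (E x) (WithLp.toLp 2 (Pi.single a' u) -
        WithLp.toLp 2 (Pi.single a (E x a a' u))))).re =
      (inner ℂ u (E x a' a' u)).re - 2 * ‖E x a a' u‖ ^ 2
        + (inner ℂ (E x a a' u) (E x a a (E x a a' u))).re := by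
  rw [map_sub, inner_sub_left, inner_sub_right, inner_sub_right]
  simp only [inner_toLp_single_left, blockOp_single]
  rw [hE.inner_apply_right x a' a, inner_self_eq_norm_sq_to_K]
  simp only [Complex.sub_re, Complex.coe_algebraMap, ← Complex.ofReal_pow, Complex.ofReal_re]
  ring

/-- With `w = E_{a,a'} u`, positivity at the test vector gives `2‖w‖² ≤ ⟨E_{a',a'} u, u⟩ + ⟨E_{a,a}
w, w⟩`, and the last term is at most `‖w‖²`. -/
lemma norm_sq_apply_le [DecidableEq A] (hE : IsStochastic E) (x : X) (a a' : A) (u : H) :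
    ‖E x a a' u‖ ^ 2 ≤ (inner ℂ u (E x a' a' u)).re := by
  have h := (hE.isPositive x).re_inner_nonneg_right (WithLp.toLp 2 (Pi.single a' u) -
    WithLp.toLp 2 (Pi.single a (E x a a' u)))
  rw [RCLike.re_eq_complex_re, hE.re_inner_blockOp_sub] at h
  linarith [hE.re_inner_diag_le x a (E x a a' u)]

lemma blockOp_eq_zero (hE : IsStochastic E) (x : X) {v : PiLp 2 (fun _ : A => H)}
    (hv : (inner ℂ v (blockOp (E x) v)).re ≤ 0) : blockOp (E x) v = 0 := by
  refine (hE.isPositive x).apply_eq_zero_of_inner_self_eq_zero ?_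
  have h := (hE.isPositive x).inner_nonneg_right v
  rw [Complex.nonneg_iff] at h
  exact Complex.ext (le_antisymm hv h.1) h.2.symm

/-- If the Schwarz inequality `‖E_{a,c} u‖² ≤ ⟨E_{c,c} u, u⟩` is an equality, then the `E_{b,b'}`
multiply like matrix units on `E_{a,c} u`. -/
lemma apply_apply_of_norm_sq_eq [DecidableEq A] (hE : IsStochastic E) (x : X) (a c : A) (u : H)
    (h : (inner ℂ u (E x c c u)).re ≤ ‖E x a c u‖ ^ 2) (b b' : A) :
    E x b b' (E x a c u) = if b' = a then E x b c u else 0 := by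
  have hle := hE.re_inner_diag_le x a (E x a c u)
  have hge := (hE.isPositive x).re_inner_nonneg_right (WithLp.toLp 2 (Pi.single c u) -
    WithLp.toLp 2 (Pi.single a (E x a c u)))
  rw [RCLike.re_eq_complex_re, hE.re_inner_blockOp_sub] at hge
  split_ifs with hb
  · subst hb
    -- Equality in Schwarz makes the quadratic form vanish at the test vector, so the positive block
    -- operator kills it; row `b` is the claim.
    have h0 := hE.blockOp_eq_zero x (v := WithLp.toLp 2 (Pi.single c u) -
      WithLp.toLp 2 (Pi.single b' (E x b' c u))) (by
        rw [hE.re_inner_blockOp_sub]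
        linarith)
    have h1 := congrArg (fun w : PiLp 2 (fun _ : A => H) => w b) h0
    simp only [map_sub, PiLp.sub_apply, blockOp_single, PiLp.zero_apply] at h1
    exact (sub_eq_zero.1 h1).symm
  -- For `w = E_{a,c} u`, `hge` and `h` give `⟨E_{a,a} w, w⟩ ≥ ‖w‖²`. The nonnegative diagonal terms
  -- add up to `‖w‖²`, so the one at `b' ≠ a` vanishes and the whole column `b'` kills `w`.
  · have hsum := hE.sum_re_inner_diag x (E x a c u)
    rw [← Finset.add_sum_erase _ _ (Finset.mem_univ a)] at hsum
    have hb' := Finset.single_le_sum (f := fun d => (inner ℂ (E x a c u) (E x d d (E x a c u))).re)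
      (fun d _ => hE.re_inner_diag_nonneg x d _) (Finset.mem_erase.2 ⟨hb, Finset.mem_univ b'⟩)
    have h0 := hE.blockOp_eq_zero x (v := WithLp.toLp 2 (Pi.single b' (E x a c u))) (by
        rw [inner_toLp_single_left, blockOp_single]
        linarith)
    have h1 := congrArg (fun w : PiLp 2 (fun _ : A => H) => w b) h0
    simpa only [blockOp_single, PiLp.zero_apply] using h1

/-- Families of operators which multiply like matrix units are stochastic. -/
lemma of_matrixUnits {E : X → A → A → (H →L[ℂ] H)}
    (hmul : ∀ x a b c, E x a b * E x b c = E x a c)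
    (hstar : ∀ x a b u w, inner ℂ u (E x a b w) = inner ℂ (E x b a u) w)
    (hone : ∀ x, ∑ a, E x a a = 1) : IsStochastic E := by
  refine ⟨fun x v => ?_, hone⟩
  rcases isEmpty_or_nonempty A with hA | ⟨⟨c⟩⟩
  · simp
  -- Factoring `E_{a,a'} = E_{c,a}* E_{c,a'}` through one fixed index `c` turns the form into a
  -- squared norm.
  · have h : ∑ a, ∑ a', inner ℂ (v a) (E x a a' (v a')) =
        inner ℂ (∑ a, E x c a (v a)) (∑ a, E x c a (v a)) := by
      rw [sum_inner]
      refine Finset.sum_congr rfl fun a _ => ?_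
      rw [inner_sum]
      refine Finset.sum_congr rfl fun a' _ => ?_
      rw [← hmul x a c a', mul_apply_eq_comp, hstar]
    rw [h, inner_self_eq_norm_sq_to_K]
    positivity

end IsStochastic

/-- If the correlation of `E` and `F` is perfectly concurrent, then the vector `E_{x,a',a} ξ`
coincides with `F_{x,a,a'} ξ`, and the Schwarz inequality is an equality at `ξ`. -/
lemma IsStochastic.eq_of_sum_le [Fintype X] [DecidableEq A] {F : X → A → A → (H →L[ℂ] H)} (hE : IsStochastic E)
    (hF : IsStochastic F) {ξ : H} (hξ : ‖ξ‖ = 1)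
    (h : (Fintype.card X * Fintype.card A : ℝ) ≤
      ∑ x : X, ∑ a : A, ∑ a' : A, (inner ℂ ξ ((E x a a' * F x a a') ξ)).re) (x : X) (a a' : A) :
    E x a' a ξ = F x a a' ξ ∧ (inner ℂ ξ (E x a a ξ)).re ≤ ‖E x a' a ξ‖ ^ 2 := by
  have hin : ∀ x a a', (inner ℂ ξ ((E x a a' * F x a a') ξ)).re =
      (inner ℂ (E x a' a ξ) (F x a a' ξ)).re := fun x a a' => by
    rw [mul_apply_eq_comp, hE.inner_apply_right]
  simp only [hin] at h
  have hsE : ∑ x : X, ∑ a : A, ∑ a' : A, (inner ℂ ξ (E x a a ξ)).re =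
      Fintype.card X * Fintype.card A := by
    simp only [Finset.sum_const, Finset.card_univ, nsmul_eq_mul, ← Finset.mul_sum,
      hE.sum_re_inner_diag, hξ]
    simp
  have hsF : ∑ x : X, ∑ a : A, ∑ a' : A, (inner ℂ ξ (F x a' a' ξ)).re =
      Fintype.card X * Fintype.card A := by
    simp only [hF.sum_re_inner_diag, hξ]
    simp
  -- The deficit of one term: it dominates both `‖E_{x,a',a} ξ - F_{x,a,a'} ξ‖²` and the Schwarz
  -- defect of `E`. By `h` the nonnegative deficits have nonpositive sum, so all of them vanish.
  let g : X → A → A → ℝ := fun x a a' => (inner ℂ ξ (E x a a ξ)).re +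
    (inner ℂ ξ (F x a' a' ξ)).re - 2 * (inner ℂ (E x a' a ξ) (F x a a' ξ)).re
  have hg : ∀ x a a', ‖E x a' a ξ - F x a a' ξ‖ ^ 2 +
      ((inner ℂ ξ (E x a a ξ)).re - ‖E x a' a ξ‖ ^ 2) ≤ g x a a' := fun x a a' => by
    have h1 := hF.norm_sq_apply_le x a a' ξ
    have h2 := norm_sub_sq (𝕜 := ℂ) (E x a' a ξ) (F x a a' ξ)
    rw [RCLike.re_eq_complex_re] at h2
    simp only [g]
    linarith
  have hg0 : ∀ x a a', 0 ≤ g x a a' := fun x a a' => by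
    have h1 := hE.norm_sq_apply_le x a' a ξ
    have h2 := sq_nonneg ‖E x a' a ξ - F x a a' ξ‖
    linarith [hg x a a']
  have hgs : ∑ x, ∑ a, ∑ a', g x a a' ≤ 0 := by
    simp only [g, Finset.sum_sub_distrib, Finset.sum_add_distrib, ← Finset.mul_sum, hsE, hsF]
    linarith
  have hgz : g x a a' ≤ 0 := by
    refine le_trans ?_ hgs
    refine le_trans ?_ (Finset.single_le_sum (f := fun x => ∑ a, ∑ a', g x a a')
      (fun x _ => Finset.sum_nonneg fun a _ => Finset.sum_nonneg fun a' _ => hg0 x a a')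
      (Finset.mem_univ x))
    refine le_trans ?_ (Finset.single_le_sum (f := fun a => ∑ a', g x a a')
      (fun a _ => Finset.sum_nonneg fun a' _ => hg0 x a a') (Finset.mem_univ a))
    exact Finset.single_le_sum (f := fun a' => g x a a') (fun a' _ => hg0 x a a')
      (Finset.mem_univ a')
  have h1 := hE.norm_sq_apply_le x a' a ξ
  have h2 := sq_nonneg ‖E x a' a ξ - F x a a' ξ‖
  have h3 := hg x a a'
  refine ⟨?_, by linarith⟩
  have h4 : ‖E x a' a ξ - F x a a' ξ‖ ^ 2 = 0 := by linarith
  exact sub_eq_zero.1 (norm_eq_zero.1 (pow_eq_zero_iff two_ne_zero |>.1 h4))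

end Stochastic

/-! ### Homomorphisms from matrix units -/

/-- A system of matrix units in a *-algebra defines a *-homomorphism on the matrix algebra. -/
def homOfMatrixUnits {A C : Type*} [Fintype A] [DecidableEq A] [Ring C] [StarRing C] [Algebra ℂ C]
    [StarModule ℂ C] (e : A → A → C)
    (hmul : ∀ a b b' c, e a b * e b' c = if b' = b then e a c else 0)
    (hstar : ∀ a b, star (e a b) = e b a) (hone : ∑ a, e a a = 1) : Matrix A A ℂ →⋆ₐ[ℂ] C :=
  let f : Matrix A A ℂ →ₗ[ℂ] C :=
    { toFun := fun T => ∑ a, ∑ a', T a a' • e a a'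
      map_add' := fun S T => by simp [add_smul, Finset.sum_add_distrib]
      map_smul' := fun c T => by simp [Finset.smul_sum, mul_smul] }
  { AlgHom.ofLinearMap f
      (by
        have h : ∀ a : A, ∑ a', (1 : Matrix A A ℂ) a a' • e a a' = e a a := fun a => by
          rw [Finset.sum_eq_single a]
          · simp
          · intro b _ hb
            simp [Matrix.one_apply_ne hb.symm]
          · simp
        change ∑ a, ∑ a', (1 : Matrix A A ℂ) a a' • e a a' = 1
        simp only [h, hone])
      (fun S T => by
        change ∑ a, ∑ a', (S * T) a a' • e a a' =
          (∑ a, ∑ a', S a a' • e a a') * ∑ a, ∑ a', T a a' • e a a'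
        simp_rw [Finset.sum_mul, Finset.mul_sum]
        refine Finset.sum_congr rfl fun a _ => ?_
        simp only [Matrix.mul_apply, Finset.sum_smul]
        rw [Finset.sum_comm]
        refine Finset.sum_congr rfl fun b _ => ?_
        refine Eq.symm ((Finset.sum_eq_single b (fun c _ hc => ?_) (by simp)).trans ?_)
        · simp only [smul_mul_smul_comm, hmul, if_neg hc, smul_zero, Finset.sum_const_zero]
        · simp only [smul_mul_smul_comm, hmul, if_true]) with
    map_star' := fun T => by
      change ∑ a, ∑ a', (star T) a a' • e a a' = star (∑ a, ∑ a', T a a' • e a a')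
      simp only [star_sum, star_smul, hstar]
      rw [Finset.sum_comm]
      rfl }

lemma homOfMatrixUnits_single {A C : Type*} [Fintype A] [DecidableEq A] [Ring C] [StarRing C]
    [Algebra ℂ C] [StarModule ℂ C] (e : A → A → C)
    (hmul : ∀ a b b' c, e a b * e b' c = if b' = b then e a c else 0)
    (hstar : ∀ a b, star (e a b) = e b a) (hone : ∑ a, e a a = 1) (a a' : A) :
    homOfMatrixUnits e hmul hstar hone (Matrix.single a a' 1) = e a a' := by
  change ∑ b, ∑ b', (Matrix.single a a' (1 : ℂ)) b b' • e b b' = e a a'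
  simp [Matrix.single_apply, ite_and]

/-! ### The free product -/

section FreeProduct

variable {X A : Type u} [Fintype A] [DecidableEq A]

/-- A closed property of elements of the free product holds everywhere as soon as it holds for the
copies of `M_A` and is stable under the *-algebra operations. -/
lemma FreeProd.induction_on {p : FreeProd X A → Prop} (b : FreeProd X A)
    (incl : ∀ x T, p (incl x T)) (algebraMap : ∀ r : ℂ, p (algebraMap ℂ _ r))
    (add : ∀ b c, p b → p c → p (b + c)) (mul : ∀ b c, p b → p c → p (b * c))
    (star : ∀ b, p b → p (star b)) (closed : IsClosed {b | p b}) : p b := by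
  have h : ∀ g (hg : g ∈ StarAlgebra.adjoin ℂ {g : BoundedFamilies X A |
      ∃ (x : X) (T : Matrix A A ℂ), g = genFamily x T}),
      p ⟨g, StarSubalgebra.le_topologicalClosure _ hg⟩ := by
    intro g hg
    induction hg using StarAlgebra.adjoin_induction with
    | mem g hg =>
      obtain ⟨x, T, rfl⟩ := hg
      exact incl x T
    | algebraMap r => exact algebraMap r
    | add g k hg hk h1 h2 => exact add _ _ h1 h2
    | mul g k hg hk h1 h2 => exact mul _ _ h1 h2
    | star g hg h => exact star _ h
  refine closed.closure_subset_iff.2 Set.Subset.rfl (Metric.mem_closure_iff.2 fun ε hε => ?_)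
  obtain ⟨g, hg, hbg⟩ := Metric.mem_closure_iff.1 b.2 ε hε
  exact ⟨⟨g, StarSubalgebra.le_topologicalClosure _ hg⟩, h g hg, hbg⟩

lemma gen_mul_gen (x : X) (a b b' c : A) :
    (gen x a b * gen x b' c : FreeProd X A) = if b' = b then gen x a c else 0 := by
  unfold gen
  rw [← map_mul]
  split_ifs with h
  · subst h
    rw [Matrix.single_mul_single_same, one_mul]
  · rw [Matrix.single_mul_single_of_ne _ _ _ _ (Ne.symm h), map_zero]

lemma star_gen (x : X) (a b : A) : star (gen x a b : FreeProd X A) = gen x b a := by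
  unfold gen
  rw [← map_star, Matrix.star_eq_conjTranspose, Matrix.conjTranspose_single, star_one]

lemma sum_gen (x : X) : ∑ a, (gen x a a : FreeProd X A) = 1 := by
  unfold gen
  rw [← map_sum, Matrix.sum_single_one, map_one]

lemma incl_eq_sum (x : X) (T : Matrix A A ℂ) :
    (incl x T : FreeProd X A) = ∑ a, ∑ a', T a a' • gen x a a' := by
  conv_lhs => rw [Matrix.matrix_eq_sum_single T]
  simp only [map_sum, gen, ← map_smul, Matrix.smul_single, smul_eq_mul, mul_one]

end FreeProduct

/-! ### Perfect strategies -/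

section Diag

variable {X Y A : Type u} [Fintype X] [DecidableEq X] [Fintype Y] [DecidableEq Y]
  [Fintype A] [DecidableEq A]

lemma coe_diagKron_diagUnit (x : X) (y : Y) :
    (diagKron (diagUnit x) (diagUnit y) : Matrix (X × Y) (X × Y) ℂ) =
      Matrix.single (x, y) (x, y) 1 := by
  change Matrix.single x x (1 : ℂ) ⊗ₖ Matrix.single y y (1 : ℂ) = _
  rw [Matrix.single_kronecker_single, one_mul]

lemma eq_sum_diagKron (ω : Diag (X × Y)) :
    ω = ∑ x, ∑ y, (ω : Matrix (X × Y) (X × Y) ℂ) (x, y) (x, y) •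
      diagKron (diagUnit x) (diagUnit y) := by
  refine Subtype.ext ?_
  rw [← Fintype.sum_prod_type'
    (f := fun x y => (ω : Matrix (X × Y) (X × Y) ℂ) (x, y) (x, y) •
      diagKron (diagUnit x) (diagUnit y)), AddSubmonoidClass.coe_finsetSum]
  have h : ∀ p : X × Y, (((ω : Matrix (X × Y) (X × Y) ℂ) (p.1, p.2) (p.1, p.2) •
      diagKron (diagUnit p.1) (diagUnit p.2) : Diag (X × Y)) : Matrix (X × Y) (X × Y) ℂ) =
      (ω : Matrix (X × Y) (X × Y) ℂ) p p • Matrix.single p p 1 := fun p => by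
    rw [← coe_diagKron_diagUnit p.1 p.2]
    rfl
  simp only [h, Matrix.smul_single, smul_eq_mul, mul_one]
  have hω : (ω : Matrix (X × Y) (X × Y) ℂ).IsDiag := ω.2
  rw [← hω.diagonal_diag]
  ext p q
  simp [Matrix.sum_apply, Matrix.diagonal_apply, Matrix.single_apply, ite_and]

lemma map_eq_sum_diagKron {M : Type*} [AddCommMonoid M] [Module ℂ M]
    (Γ : Diag (X × Y) →ₗ[ℂ] M) (ω : Diag (X × Y)) :
    Γ ω = ∑ x, ∑ y, (ω : Matrix (X × Y) (X × Y) ℂ) (x, y) (x, y) •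
      Γ (diagKron (diagUnit x) (diagUnit y)) := by
  conv_lhs => rw [eq_sum_diagKron ω]
  simp only [map_sum, map_smul]

lemma trAgainst_diagUnit (P : Diag (X × X)) (Q : Matrix (A × A) (A × A) ℂ) (x y : X)
    (a a' b b' : A) :
    trAgainst P Q (diagKron (diagUnit x) (diagUnit y) ⊗ₜ[ℂ]
      matKron (Matrix.single a a' 1) (Matrix.single b b' 1)) =
      (P : Matrix (X × X) (X × X) ℂ) (x, y) (x, y) * Q (a', b') (a, b) := by
  change Matrix.trace (((diagKron (diagUnit x) (diagUnit y) : Matrix (X × X) (X × X) ℂ) ⊗ₖ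
    (Matrix.single a a' (1 : ℂ) ⊗ₖ Matrix.single b b' (1 : ℂ))) *
      ((P : Matrix (X × X) (X × X) ℂ) ⊗ₖ Q)) = _
  rw [← Matrix.mul_kronecker_mul, Matrix.trace_kronecker, coe_diagKron_diagUnit,
    Matrix.single_kronecker_single, one_mul, Matrix.trace_single_mul, Matrix.trace_single_mul]
  simp

lemma beta_shuffle (P : Diag (X × X)) (Q : Matrix (A × A) (A × A) ℂ) :
    β P Q (shuffle X A (Ecq X A ⊗ₜ[ℂ] EcqOp X A)) =
      ∑ y, ∑ b, ∑ b', ∑ x, ∑ a, ∑ a',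
        ((P : Matrix (X × X) (X × X) ℂ) (x, y) (x, y) * Q (a', b') (a, b)) •
          (gen x a a' * gen y b' b) := by
  unfold Ecq EcqOp
  simp only [TensorProduct.sum_tmul, TensorProduct.tmul_sum, map_sum]
  refine Finset.sum_congr rfl fun y _ => Finset.sum_congr rfl fun b _ => Finset.sum_congr rfl
    fun b' _ => Finset.sum_congr rfl fun x _ => Finset.sum_congr rfl fun a _ => Finset.sum_congr rfl
    fun a' _ => ?_
  rw [← trAgainst_diagUnit]
  rfl

/-- Both sides expand to the same sum of `P_{(x,y),(x,y)} Q_{(a',b'),(a,b)} τ(e_{x,a,a'}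
e_{y,b',b})`; the reversed indices in `E_cq^op` match those in the formula for `Γ`. -/
lemma map_beta_shuffle {Γ : Diag (X × X) →ₗ[ℂ] Matrix (A × A) (A × A) ℂ}
    {τ : FreeProd X A →ₗ[ℂ] ℂ} (h : IsGivenBy Γ τ) (P : Diag (X × X))
    (Q : Matrix (A × A) (A × A) ℂ) :
    τ (β P Q (shuffle X A (Ecq X A ⊗ₜ[ℂ] EcqOp X A))) = (Γ P * Q).trace := by
  have hxy : ∀ x y, (Γ (diagKron (diagUnit x) (diagUnit y)) * Q).trace =
      ∑ b, ∑ b', ∑ a, ∑ a', Q (a', b') (a, b) * τ (gen x a a' * gen y b' b) := fun x y => by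
    have e : (Γ (diagKron (diagUnit x) (diagUnit y)) * Q).trace =
        ∑ a, ∑ b, ∑ a', ∑ b', τ (gen x a a' * gen y b' b) * Q (a', b') (a, b) := by
      simp only [Matrix.trace, Matrix.diag_apply, Matrix.mul_apply, Fintype.sum_prod_type]
      simp only [h x y _ _ _ _]
    rw [e, Finset.sum_comm]
    refine Finset.sum_congr rfl fun b _ => ?_
    rw [Finset.sum_comm (s := (Finset.univ : Finset A)) (t := (Finset.univ : Finset A))
      (f := fun b' a => ∑ a', Q (a', b') (a, b) * τ (gen x a a' * gen y b' b))]
    refine Finset.sum_congr rfl fun a _ => ?_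
    rw [Finset.sum_comm]
    simp only [mul_comm]
  rw [beta_shuffle, map_eq_sum_diagKron]
  simp only [map_sum, map_smul, Finset.sum_mul, Matrix.trace_sum, Matrix.smul_mul,
    Matrix.trace_smul, hxy]
  rw [Finset.sum_comm (s := (Finset.univ : Finset X)) (t := (Finset.univ : Finset X))
    (f := fun x y => (P : Matrix (X × X) (X × X) ℂ) (x, y) (x, y) •
      ∑ b, ∑ b', ∑ a, ∑ a', Q (a', b') (a, b) * τ (gen x a a' * gen y b' b))]
  refine Finset.sum_congr rfl fun y _ => ?_
  refine ((Finset.sum_congr rfl fun b _ => Finset.sum_comm).trans Finset.sum_comm).trans ?_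
  simp only [Finset.mul_sum, smul_eq_mul, mul_assoc]

lemma isPerfect_iff_annihilates (φ : Game X X A A)
    {Γ : Diag (X × X) →ₗ[ℂ] Matrix (A × A) (A × A) ℂ} {τ : FreeProd X A →ₗ[ℂ] ℂ}
    (h : IsGivenBy Γ τ) : IsPerfect φ Γ ↔ Annihilates τ φ := by
  unfold IsPerfect Annihilates
  simp only [map_beta_shuffle h]

lemma trace_maxEntCl : (maxEntCl X : Matrix (X × X) (X × X) ℂ).trace = Fintype.card X := by
  unfold maxEntCl
  rw [AddSubmonoidClass.coe_finsetSum, Matrix.trace_sum]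
  simp [coe_diagKron_diagUnit]

/-- Clearing the denominator keeps the identity valid for empty `A`, where both sides are zero. -/
lemma trace_mul_maxEnt (M : Matrix (A × A) (A × A) ℂ) :
    (Fintype.card A : ℂ) * (M * maxEnt A).trace = ∑ a, ∑ a', M (a, a) (a', a') := by
  unfold maxEnt
  rcases isEmpty_or_nonempty A with hA | hA
  · simp
  · rw [Matrix.mul_smul, Matrix.trace_smul, smul_eq_mul, ← mul_assoc, mul_inv_cancel₀ (by simp),
      one_mul]
    simp only [Matrix.mul_sum, Matrix.trace_sum, Matrix.single_kronecker_single, one_mul,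
      Matrix.trace_mul_single]
    rw [Finset.sum_comm]
    simp

/-- Perfect strategies of concurrent games have maximal concurrency. -/
lemma sum_eq_of_isPerfect {φ : Game X X A A} (hφ : φ.IsConcurrent)
    {Γ : Diag (X × X) →ₗ[ℂ] Matrix (A × A) (A × A) ℂ}
    (htr : ∀ ω, (Γ ω).trace = (ω : Matrix (X × X) (X × X) ℂ).trace) (hΓ : IsPerfect φ Γ) :
    ∑ x, ∑ a, ∑ a', Γ (diagKron (diagUnit x) (diagUnit x)) (a, a) (a', a') =
      (Fintype.card X : ℂ) * Fintype.card A := by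
  have h := hΓ ⟨maxEntCl X, isStarProjection_maxEntCl X⟩
  rw [hφ, mul_sub, mul_one, Matrix.trace_sub, htr, trace_maxEntCl, sub_eq_zero] at h
  rw [mul_comm, h, trace_mul_maxEnt]
  unfold maxEntCl
  simp only [map_sum, Matrix.sum_apply]
  rw [Finset.sum_comm]
  refine Finset.sum_congr rfl fun a _ => Finset.sum_comm

end Diag

/-! ### From commuting strategies to tracial states -/

/-- The functional `T ↦ ⟨T η, η⟩`. -/
def vectorFunctional {H : Type*} [NormedAddCommGroup H] [InnerProductSpace ℂ H] (η : H) :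
    (H →L[ℂ] H) →ₗ[ℂ] ℂ where
  toFun T := inner ℂ η (T η)
  map_add' S T := by simp
  map_smul' c T := by simp

lemma vectorFunctional_apply {H : Type*} [NormedAddCommGroup H] [InnerProductSpace ℂ H] (η : H)
    (T : H →L[ℂ] H) : vectorFunctional η T = inner ℂ η (T η) := rfl

/-! ### The cyclic subspace of the commutant. -/

section Commutant

variable {X A : Type u} {H : Type u} [NormedAddCommGroup H] [InnerProductSpace ℂ H]

/-- The closure of `E' ξ`, where `E'` is the commutant of the family `E`. -/
def commutantSpan (E : X → A → A → (H →L[ℂ] H)) (ξ : H) : Submodule ℂ H :=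
  Submodule.topologicalClosure
    { carrier := {v | ∃ w : H →L[ℂ] H, (∀ x a a', E x a a' * w = w * E x a a') ∧ w ξ = v}
      add_mem' := by
        rintro _ _ ⟨w, hw, rfl⟩ ⟨w', hw', rfl⟩
        exact ⟨w + w', fun x a a' => by rw [mul_add, add_mul, hw, hw'], rfl⟩
      zero_mem' := ⟨0, fun _ _ _ => by simp, rfl⟩
      smul_mem' := by
        rintro c _ ⟨w, hw, rfl⟩
        exact ⟨c • w, fun x a a' => by rw [mul_smul_comm, smul_mul_assoc, hw], rfl⟩ }

lemma apply_mem_commutantSpan {E : X → A → A → (H →L[ℂ] H)} {ξ : H} {w : H →L[ℂ] H}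
    (hw : ∀ x a a', E x a a' * w = w * E x a a') : w ξ ∈ commutantSpan E ξ :=
  Submodule.le_topologicalClosure _ ⟨w, hw, rfl⟩

lemma commutantSpan_induction {E : X → A → A → (H →L[ℂ] H)} {ξ : H} {p : H → Prop}
    (hp : IsClosed {v | p v})
    (h : ∀ w : H →L[ℂ] H, (∀ x a a', E x a a' * w = w * E x a a') → p (w ξ)) {v : H}
    (hv : v ∈ commutantSpan E ξ) : p v := by
  refine closure_minimal (t := {v | p v}) ?_ hp hv
  rintro _ ⟨w, hw, rfl⟩
  exact h w hw

lemma self_mem_commutantSpan (E : X → A → A → (H →L[ℂ] H)) (ξ : H) : ξ ∈ commutantSpan E ξ :=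
  apply_mem_commutantSpan (w := 1) fun _ _ _ => by rw [mul_one, one_mul]

lemma isClosed_commutantSpan (E : X → A → A → (H →L[ℂ] H)) (ξ : H) :
    IsClosed (commutantSpan E ξ : Set H) :=
  Submodule.isClosed_topologicalClosure _

/-- Elements of the commutant leave `commutantSpan E ξ` invariant. -/
lemma commutant_apply_mem {E : X → A → A → (H →L[ℂ] H)} {ξ : H} {f : H →L[ℂ] H}
    (hf : ∀ x a a', E x a a' * f = f * E x a a') {v : H} (hv : v ∈ commutantSpan E ξ) :
    f v ∈ commutantSpan E ξ := by
  refine commutantSpan_induction (p := fun v => f v ∈ commutantSpan E ξ)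
    ((isClosed_commutantSpan E ξ).preimage f.continuous) (fun w hw => ?_) hv
  exact apply_mem_commutantSpan (w := f * w) fun x a a' => by
    rw [← mul_assoc, hf, mul_assoc, hw, mul_assoc]

/-- For `w` in the commutant, `E_{x,a,a'} w ξ = w E_{x,a,a'} ξ = w F_{x,a',a} ξ`, and `w F_{x,a',a}`
is again in the commutant. -/
lemma family_apply_mem {E F : X → A → A → (H →L[ℂ] H)} {ξ : H}
    (hcomm : ∀ x a a' y b b', E x a a' * F y b b' = F y b b' * E x a a')
    (hξ : ∀ x a a', E x a a' ξ = F x a' a ξ) (x : X) (a a' : A) {v : H}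
    (hv : v ∈ commutantSpan E ξ) : E x a a' v ∈ commutantSpan E ξ := by
  refine commutantSpan_induction (p := fun v => E x a a' v ∈ commutantSpan E ξ)
    ((isClosed_commutantSpan E ξ).preimage (E x a a').continuous) (fun w hw => ?_) hv
  rw [← mul_apply_eq_comp, hw, mul_apply_eq_comp, hξ]
  refine apply_mem_commutantSpan (w := w * F x a' a) fun y b b' => ?_
  rw [← mul_assoc, hw, mul_assoc, hcomm, mul_assoc]

/-- The relations hold at `ξ`; pulling a commutant element `w` out to the left gives them at `w ξ`,
and continuity does the rest. -/
lemma family_mul_apply [DecidableEq A] {E : X → A → A → (H →L[ℂ] H)} {ξ : H}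
    (hξ : ∀ x a b b' c, E x a b (E x b' c ξ) = if b' = b then E x a c ξ else 0)
    (x : X) (a b b' c : A) {v : H} (hv : v ∈ commutantSpan E ξ) :
    E x a b (E x b' c v) = if b' = b then E x a c v else 0 := by
  refine commutantSpan_induction
    (p := fun v => E x a b (E x b' c v) = if b' = b then E x a c v else 0) ?_ (fun w hw => ?_) hv
  · refine isClosed_eq (by fun_prop) ?_
    split_ifs <;> fun_prop
  · have h1 : ∀ x a a' u, E x a a' (w u) = w (E x a a' u) := fun x a a' u =>
      congrArg (fun T : H →L[ℂ] H => T u) (hw x a a')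
    rw [h1, h1, hξ]
    split_ifs
    · rw [h1]
    · rw [map_zero]

end Commutant

/-! ### Traciality of the vector state. -/

section Trace

variable {X A : Type u} [Fintype A] [DecidableEq A]

lemma continuous_starAlgHom {C : Type*} [CStarAlgebra C] (π : FreeProd X A →⋆ₐ[ℂ] C) :
    Continuous π :=
  AddMonoidHomClass.continuous_of_bound π 1 fun b => by
    simpa using NonUnitalStarAlgHom.norm_apply_le π b

/-- If on a vector `η` the matrix units act as a family in the commutant with reversed indices,
then the corresponding vector functional is tracial. -/
lemma isTracialState_vectorFunctional {K : Type u} [NormedAddCommGroup K] [InnerProductSpace ℂ K]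
    [CompleteSpace K] (π : FreeProd X A →⋆ₐ[ℂ] (K →L[ℂ] K)) {η : K} (hη : ‖η‖ = 1)
    (f : X → A → A → (K →L[ℂ] K)) (hstar : ∀ x a a', star (f x a a') = f x a' a)
    (hcomm : ∀ x a a' y b b', Commute (π (gen x a a')) (f y b b'))
    (hf : ∀ x a a', π (gen x a a') η = f x a' a η) :
    IsTracialState (vectorFunctional η ∘ₗ π.toAlgHom.toLinearMap) := by
  have happ : ∀ b, (vectorFunctional η ∘ₗ π.toAlgHom.toLinearMap) b = inner ℂ η (π b η) :=
    fun _ => rfl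
  have hinner : ∀ (T : K →L[ℂ] K) u v, inner ℂ u (T v) = inner ℂ ((star T) u) v :=
    fun T u v => (ContinuousLinearMap.adjoint_inner_left T v u).symm
  -- Commutation spreads from the generators to the whole algebra; stability under `star` needs the
  -- family `f` to be closed under adjoints.
  have hπ : ∀ b y c c', Commute (π b) (f y c c') := by
    intro b y c c'
    refine FreeProd.induction_on (p := fun b => ∀ c c', Commute (π b) (f y c c')) b ?_ ?_ ?_ ?_ ?_ ?_
      c c'
    · intro x T c c'
      rw [incl_eq_sum]
      simp only [map_sum, map_smul]
      exact Commute.sum_left _ _ _ fun a _ => Commute.sum_left _ _ _ fun a' _ =>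
        (hcomm x a a' y c c').smul_left _
    · intro r c c'
      rw [AlgHomClass.commutes]
      exact Algebra.commutes _ _
    · intro b d hb hd c c'
      rw [map_add]
      exact (hb c c').add_left (hd c c')
    · intro b d hb hd c c'
      rw [map_mul]
      exact (hb c c').mul_left (hd c c')
    · intro b hb c c'
      rw [map_star, ← hstar, commute_star_star]
      exact hb c' c
    · simp only [Set.ofPred_forall]
      refine isClosed_iInter fun c => isClosed_iInter fun c' => ?_
      have h1 := continuous_starAlgHom π
      exact isClosed_eq (h1.mul continuous_const) (continuous_const.mul h1)
  refine ⟨fun b => ?_, ?_, fun b c => ?_⟩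
  · rw [happ, map_mul, map_star, mul_apply_eq_comp, hinner, star_star, inner_self_eq_norm_sq_to_K]
    positivity
  · rw [happ, map_one, one_apply_eq_self, inner_self_eq_norm_sq_to_K, hη]
    simp
  -- Induction on `c` with `b` universally quantified, so that for a product the two factors can be
  -- cycled round one after the other.
  · have hc : ∀ b, inner ℂ η (π (b * c) η) = inner ℂ η (π (c * b) η) := by
      refine FreeProd.induction_on
        (p := fun c => ∀ b, inner ℂ η (π (b * c) η) = inner ℂ η (π (c * b) η)) c ?_ ?_ ?_ ?_ ?_ ?_
      · intro x T b
        rw [incl_eq_sum]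
        simp only [Finset.mul_sum, Finset.sum_mul, map_sum, mul_smul_comm, smul_mul_assoc, map_smul,
          _root_.sum_apply, inner_sum, smul_apply, inner_smul_right]
        refine Finset.sum_congr rfl fun a _ => Finset.sum_congr rfl fun a' _ => congrArg _ ?_
        -- For a generator `g` with partner `f`: `⟨b g η, η⟩ = ⟨b f η, η⟩ = ⟨f b η, η⟩ = ⟨b η, f* η⟩
        -- = ⟨b η, g* η⟩ = ⟨g b η, η⟩`.
        rw [map_mul, map_mul, mul_apply_eq_comp, mul_apply_eq_comp, hf, ← mul_apply_eq_comp,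
          (hπ b x a' a).eq, mul_apply_eq_comp, hinner, hstar, ← hf, ← star_gen, map_star,
          ← hinner]
      · intro r b
        rw [Algebra.commutes]
      · intro c d hc hd b
        simp only [mul_add, add_mul, map_add, _root_.add_apply, inner_add_right, hc, hd]
      · intro c d hc hd b
        rw [← mul_assoc, hd, ← mul_assoc, hc, mul_assoc]
      · intro c hc b
        have hs : ∀ d, inner ℂ η (π (star d) η) = star (inner ℂ η (π d η)) := fun d => by
          rw [map_star, hinner, star_star, RCLike.star_def, inner_conj_symm]
        have h := hc (star b)
        rw [← star_star b, ← star_mul, ← star_mul, hs, hs, h]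
      · simp only [Set.ofPred_forall]
        refine isClosed_iInter fun b => ?_
        have h1 := continuous_starAlgHom π
        have h2 : Continuous fun c => π (b * c) := h1.comp (continuous_const.mul continuous_id)
        have h3 : Continuous fun c => π (c * b) := h1.comp (continuous_id.mul continuous_const)
        exact isClosed_eq (by fun_prop) (by fun_prop)
    exact hc b

/-- A perfectly concurrent commuting strategy gives rise to a tracial vector functional on the
image of a representation of the free product. -/
theorem exists_tracial_vectorFunctional {H : Type u} [NormedAddCommGroup H] [InnerProductSpace ℂ H]
    [CompleteSpace H] {ξ : H} (hξ : ‖ξ‖ = 1) {E F : X → A → A → (H →L[ℂ] H)}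
    (hE : IsStochastic E) (hF : IsStochastic F)
    (hcomm : ∀ x a a' y b b', E x a a' * F y b b' = F y b b' * E x a a')
    (h : ∀ x a a', E x a' a ξ = F x a a' ξ ∧ (inner ℂ ξ (E x a a ξ)).re ≤ ‖E x a' a ξ‖ ^ 2) :
    ∃ (K : Submodule ℂ H) (_ : CompleteSpace K) (π : FreeProd X A →⋆ₐ[ℂ] (K →L[ℂ] K)) (η : K),
      IsTracialState (vectorFunctional η ∘ₗ π.toAlgHom.toLinearMap) ∧
      ∀ x y a a' b b', vectorFunctional η (π (gen x a a' * gen y b' b)) =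
        inner ℂ ξ ((E x a a' * F y b b') ξ) := by
  have hmul : ∀ x a b b' c, E x a b (E x b' c ξ) = if b' = b then E x a c ξ else 0 :=
    fun x a b b' c => by
      rw [hE.apply_apply_of_norm_sq_eq x b' c ξ (h x c b').2]
      simp only [eq_comm]
  have hEF : ∀ x a a', E x a a' ξ = F x a' a ξ := fun x a a' => (h x a' a).1
  let K := commutantSpan E ξ
  have hK : CompleteSpace K := (isClosed_commutantSpan E ξ).completeSpace_coe
  let e : X → A → A → (K →L[ℂ] K) := fun x a a' =>
    ((E x a a').comp K.subtypeL).codRestrict K fun v => family_apply_mem hcomm hEF x a a' v.2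
  let f : X → A → A → (K →L[ℂ] K) := fun x a a' =>
    ((F x a a').comp K.subtypeL).codRestrict K fun v =>
      commutant_apply_mem (fun y b b' => hcomm y b b' x a a') v.2
  have he : ∀ x a a' (v : K), (e x a a' v : H) = E x a a' v := fun _ _ _ _ => rfl
  have hf : ∀ x a a' (v : K), (f x a a' v : H) = F x a a' v := fun _ _ _ _ => rfl
  let η : K := ⟨ξ, self_mem_commutantSpan E ξ⟩
  have hη : ‖η‖ = 1 := hξ
  have hnt : Nontrivial K := ⟨η, 0, fun h0 => by rw [h0, norm_zero] at hη; exact zero_ne_one hη⟩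
  have hestar : ∀ x a b, star (e x a b) = e x b a := fun x a b => by
    refine ((ContinuousLinearMap.eq_adjoint_iff _ _).2 fun u v => ?_).symm
    rw [Submodule.coe_inner, Submodule.coe_inner, he, he, hE.inner_apply_right]
  have hfstar : ∀ x a b, star (f x a b) = f x b a := fun x a b => by
    refine ((ContinuousLinearMap.eq_adjoint_iff _ _).2 fun u v => ?_).symm
    rw [Submodule.coe_inner, Submodule.coe_inner, hf, hf, hF.inner_apply_right]
  have hemul : ∀ x a b b' c, e x a b * e x b' c = if b' = b then e x a c else 0 :=
    fun x a b b' c => by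
      ext v
      rw [mul_apply_eq_comp, he, he, family_mul_apply hmul x a b b' c v.2]
      split_ifs <;> rfl
  have heone : ∀ x, ∑ a, e x a a = 1 := fun x => by
    ext v
    have h1 := congrArg (fun T : H →L[ℂ] H => T v) (hE.2 x)
    simp only [_root_.sum_apply, one_apply_eq_self] at h1
    simp only [_root_.sum_apply, one_apply_eq_self, AddSubmonoidClass.coe_finsetSum, he, h1]
  let ρ : Rep X A :=
    { C := K →L[ℂ] K
      hom := fun x => homOfMatrixUnits (e x) (hemul x) (hestar x) (heone x) }
  let π : FreeProd X A →⋆ₐ[ℂ] (K →L[ℂ] K) := evalAt ρ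
  have hπ : ∀ x a a', π (gen x a a') = e x a a' := fun x a a' =>
    homOfMatrixUnits_single (e x) (hemul x) (hestar x) (heone x) a a'
  refine ⟨K, hK, π, η, ?_, fun x y a a' b b' => ?_⟩
  · refine isTracialState_vectorFunctional π hη f hfstar (fun x a a' y b b' => ?_)
      fun x a a' => ?_
    · rw [hπ]
      ext v
      rw [mul_apply_eq_comp, mul_apply_eq_comp, he, hf, hf, he, ← mul_apply_eq_comp, hcomm,
        mul_apply_eq_comp]
    · rw [hπ]
      exact Subtype.ext (hEF x a a')
  -- The second generator acts directly on `ξ`, where `E_{y,b',b} ξ = F_{y,b,b'} ξ`; this is the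
  -- source of the reversed indices.
  · rw [vectorFunctional_apply, map_mul, hπ, hπ, mul_apply_eq_comp, Submodule.coe_inner, he, he,
      mul_apply_eq_comp, ← hEF]

end Trace

/-! ### From tracial states to commuting strategies -/

/-- Polarization: the values of `τ` at `c* c` for `c = b`, `1 + b` and `1 + i b` are real, which
fixes the imaginary and real parts of `τ(b*)`. -/
lemma IsTracialState.map_star {R : Type*} [Ring R] [StarRing R] [Algebra ℂ R] [StarModule ℂ R]
    {τ : R →ₗ[ℂ] ℂ} (hτ : IsTracialState τ) (b : R) : τ (star b) = star (τ b) := by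
  have h1 := hτ.nonneg (1 + b)
  have h2 := hτ.nonneg (1 + Complex.I • b)
  have h3 := hτ.nonneg b
  have e1 : star (1 + b) * (1 + b) = 1 + b + star b + star b * b := by
    rw [star_add, star_one]
    noncomm_ring
  have e2 : star (1 + Complex.I • b) * (1 + Complex.I • b) =
      1 + Complex.I • b - Complex.I • star b + star b * b := by
    rw [star_add, star_one, star_smul, add_mul, mul_add, mul_add, smul_mul_smul_comm]
    simp [sub_eq_add_neg, add_assoc]
  rw [e1] at h1
  rw [e2] at h2
  simp only [map_add, map_sub, map_smul, hτ.map_one, smul_eq_mul, Complex.nonneg_iff,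
    Complex.add_re, Complex.add_im, Complex.sub_re, Complex.sub_im, Complex.mul_re, Complex.mul_im,
    Complex.I_re, Complex.I_im, Complex.one_re, Complex.one_im] at h1 h2 h3
  apply Complex.ext
  · simp only [RCLike.star_def, Complex.conj_re]
    linarith [h1.2, h2.2, h3.2]
  · simp only [RCLike.star_def, Complex.conj_im]
    linarith [h1.2, h2.2, h3.2]

lemma inner_self_eq_ofReal_norm_sq {V : Type*} [SeminormedAddCommGroup V] [InnerProductSpace ℂ V]
    (v : V) : inner ℂ v v = ((‖v‖ ^ 2 : ℝ) : ℂ) := by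
  rw [inner_self_eq_norm_sq_to_K, Complex.ofReal_pow]
  rfl

/-! ### Extending matrix units from a pre-Hilbert space to its completion. -/

section PreHilbert

variable {D : Type*} [SeminormedAddCommGroup D] [InnerProductSpace ℂ D]

open UniformSpace (Completion)

/-- The completion is separated, so it identifies vectors that differ by a null vector; no explicit
quotient by the null space is needed. -/
lemma completion_coe_eq_of_inner_eq {p q : D} (h : ∀ u : D, inner ℂ u p = inner ℂ u q) :
    (p : Completion D) = q := by
  rw [← sub_eq_zero, ← Completion.coe_sub, ← norm_eq_zero, Completion.norm_coe]
  have h1 : inner ℂ (p - q) (p - q) = 0 := by rw [inner_sub_right, h, sub_self]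
  rw [inner_self_eq_norm_sq_to_K] at h1
  simpa using h1

variable {X A : Type*} [Fintype A]

/-- A family of operators on a pre-Hilbert space which behaves like matrix units with respect to the
inner product. -/
structure IsWeakMatrixUnits (l : X → A → A → (D →ₗ[ℂ] D)) : Prop where
  mul : ∀ x a b c u v, inner ℂ u (l x a b (l x b c v)) = inner ℂ u (l x a c v)
  adj : ∀ x a b u v, inner ℂ u (l x a b v) = inner ℂ (l x b a u) v
  one : ∀ x u v, ∑ a, inner ℂ u (l x a a v) = inner ℂ u v

namespace IsWeakMatrixUnits

variable {l : X → A → A → (D →ₗ[ℂ] D)}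

lemma inner_self_apply (hl : IsWeakMatrixUnits l) (x : X) (a b : A) (v : D) :
    inner ℂ v (l x b b v) = ((‖l x a b v‖ ^ 2 : ℝ) : ℂ) := by
  rw [← hl.mul x b a b, hl.adj, inner_self_eq_ofReal_norm_sq]

/-- Weakly, `l_{c,c} = l_{a,c}* l_{a,c}` and the `l_{c,c}` sum to the identity, so `∑_c ‖l_{a,c} v‖²
= ‖v‖²`. -/
lemma norm_apply_le (hl : IsWeakMatrixUnits l) (x : X) (a b : A) (v : D) :
    ‖l x a b v‖ ≤ 1 * ‖v‖ := by
  have h := hl.one x v v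
  rw [Finset.sum_congr rfl fun c _ => hl.inner_self_apply x a c v, inner_self_eq_ofReal_norm_sq] at h
  have h' : ∑ c, ‖l x a c v‖ ^ 2 = ‖v‖ ^ 2 := by exact_mod_cast h
  rw [one_mul, ← sq_le_sq₀ (norm_nonneg _) (norm_nonneg _), ← h']
  exact Finset.single_le_sum (f := fun c => ‖l x a c v‖ ^ 2) (fun c _ => by positivity)
    (Finset.mem_univ b)

/-- The bounded extensions to the completion. -/
def extend (hl : IsWeakMatrixUnits l) (x : X) (a b : A) : Completion D →L[ℂ] Completion D :=
  ((l x a b).mkContinuous 1 (hl.norm_apply_le x a b)).completion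

lemma extend_coe (hl : IsWeakMatrixUnits l) (x : X) (a b : A) (v : D) :
    hl.extend x a b (v : Completion D) = (l x a b v : D) := by
  unfold extend
  rw [ContinuousLinearMap.completion_apply_coe]
  rfl

end IsWeakMatrixUnits

end PreHilbert

open UniformSpace (Completion)

lemma IsWeakMatrixUnits.isStochastic_extend {D : Type u} [SeminormedAddCommGroup D]
    [InnerProductSpace ℂ D] {X A : Type u} [Fintype A] {l : X → A → A → (D →ₗ[ℂ] D)}
    (hl : IsWeakMatrixUnits l) : IsStochastic hl.extend := by
  refine .of_matrixUnits (fun x a b c => ?_) (fun x a b u w => ?_) fun x => ?_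
  · ext v
    refine Completion.induction_on v (isClosed_eq (by fun_prop) (by fun_prop)) fun v => ?_
    rw [mul_apply_eq_comp, hl.extend_coe, hl.extend_coe, hl.extend_coe]
    exact completion_coe_eq_of_inner_eq fun u => hl.mul x a b c u v
  · refine Completion.induction_on₂ u w (isClosed_eq (by fun_prop) (by fun_prop)) fun u w => ?_
    rw [hl.extend_coe, hl.extend_coe, Completion.inner_coe, Completion.inner_coe, hl.adj]
  · ext v
    refine Completion.induction_on v (isClosed_eq (by fun_prop) (by fun_prop)) fun v => ?_
    simp only [_root_.sum_apply, hl.extend_coe, one_apply_eq_self]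
    have hs : ∑ a, ((l x a a v : D) : Completion D) = ((∑ a, l x a a v : D) : Completion D) :=
      (map_sum (Completion.toComplL (𝕜 := ℂ) (E := D)) _ _).symm
    rw [hs]
    exact completion_coe_eq_of_inner_eq fun u => by rw [inner_sum, hl.one]

/-! ### The GNS construction for a tracial state. -/

section GNS

variable {X A : Type u} [Fintype A] [DecidableEq A]

/-- The free algebra on the matrix units, mapped to the free product. -/
def freeToFreeProd (X A : Type u) [Fintype A] [DecidableEq A] :
    FreeAlgebra ℂ (X × A × A) →ₐ[ℂ] FreeProd X A :=
  FreeAlgebra.lift ℂ fun i => gen i.1 i.2.1 i.2.2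

lemma freeToFreeProd_ι (x : X) (a b : A) :
    freeToFreeProd X A (FreeAlgebra.ι ℂ (x, a, b)) = gen x a b :=
  FreeAlgebra.lift_ι_apply _ _

/-- The semi-inner product `⟨p, q⟩ = τ(p* q)`. -/
abbrev gnsCore {τ : FreeProd X A →ₗ[ℂ] ℂ} (hτ : IsTracialState τ) :
    PreInnerProductSpace.Core ℂ (FreeAlgebra ℂ (X × A × A)) where
  inner p q := τ (star (freeToFreeProd X A p) * freeToFreeProd X A q)
  conj_inner_symm p q := by
    rw [← RCLike.star_def, ← hτ.map_star, star_mul, star_star]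
  re_inner_nonneg p := (Complex.nonneg_iff.1 (hτ.nonneg _)).1
  add_left p q r := by rw [map_add, star_add, add_mul, map_add]
  smul_left p q c := by
    rw [map_smul, star_smul, smul_mul_assoc, map_smul, smul_eq_mul, RCLike.star_def]

/-- Left and right multiplications commute, and the vector `1` implements `τ`. The pre-Hilbert space
is the free algebra because the free product itself lives one universe above the required Hilbert
space; hence the relations hold only weakly before completion. -/
theorem exists_commuting_of_tracialState {τ : FreeProd X A →ₗ[ℂ] ℂ} (hτ : IsTracialState τ) :
    ∃ (H : Type u) (_ : NormedAddCommGroup H) (_ : InnerProductSpace ℂ H) (_ : CompleteSpace H)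
      (ξ : H) (E F : X → A → A → (H →L[ℂ] H)), ‖ξ‖ = 1 ∧ IsStochastic E ∧ IsStochastic F ∧
      (∀ x a a' y b b', E x a a' * F y b b' = F y b b' * E x a a') ∧
      ∀ x y a a' b b', inner ℂ ξ ((E x a a' * F y b b') ξ) = τ (gen x a a' * gen y b' b) := by
  let D := FreeAlgebra ℂ (X × A × A)
  let θ := freeToFreeProd X A
  let _ : SeminormedAddCommGroup D :=
    InnerProductSpace.Core.toSeminormedAddCommGroup (c := gnsCore hτ)
  let _ : InnerProductSpace ℂ D := InnerProductSpace.ofCore (gnsCore hτ)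
  have hin : ∀ p q : D, inner ℂ p q = τ (star (θ p) * θ q) := fun _ _ => rfl
  have hι : ∀ x a b, θ (FreeAlgebra.ι ℂ (x, a, b)) = gen x a b := freeToFreeProd_ι
  let l : X → A → A → (D →ₗ[ℂ] D) := fun x a b => LinearMap.mulLeft ℂ (FreeAlgebra.ι ℂ (x, a, b))
  -- Right multiplication reverses products; swapping the indices restores the matrix unit
  -- relations.
  let r : X → A → A → (D →ₗ[ℂ] D) := fun x a b => LinearMap.mulRight ℂ (FreeAlgebra.ι ℂ (x, b, a))
  have hlv : ∀ x a b v, θ (l x a b v) = gen x a b * θ v := fun x a b v => by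
    rw [← hι, ← map_mul]
    rfl
  have hrv : ∀ x a b v, θ (r x a b v) = θ v * gen x b a := fun x a b v => by
    rw [← hι, ← map_mul]
    rfl
  have hl : IsWeakMatrixUnits l :=
    { mul := fun x a b c u v => by
        rw [hin, hin, hlv, hlv, hlv, ← mul_assoc (gen x a b), gen_mul_gen, if_pos rfl]
      adj := fun x a b u v => by rw [hin, hin, hlv, hlv, star_mul, star_gen, mul_assoc]
      one := fun x u v => by
        simp only [hin, hlv]
        rw [← map_sum, ← Finset.mul_sum, ← Finset.sum_mul, sum_gen, one_mul] }
  have hr : IsWeakMatrixUnits r :=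
    { mul := fun x a b c u v => by
        rw [hin, hin, hrv, hrv, hrv, mul_assoc (θ v), gen_mul_gen, if_pos rfl]
      adj := fun x a b u v => by
        -- Traciality is what makes right multiplication by `b*` the adjoint of right multiplication
        -- by `b`.
        rw [hin, hin, hrv, hrv, star_mul, star_gen, ← mul_assoc, hτ.map_mul_comm, ← mul_assoc]
      one := fun x u v => by
        simp only [hin, hrv]
        rw [← map_sum, ← Finset.mul_sum, ← Finset.mul_sum, sum_gen, mul_one] }
  refine ⟨Completion D, inferInstance, inferInstance, inferInstance, ((1 : D) : Completion D),
    hl.extend, hr.extend, ?_, hl.isStochastic_extend, hr.isStochastic_extend, ?_, ?_⟩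
  · rw [Completion.norm_coe, ← sq_eq_sq₀ (norm_nonneg _) zero_le_one]
    have h : ((‖(1 : D)‖ ^ 2 : ℝ) : ℂ) = 1 := by
      have h1 := inner_self_eq_ofReal_norm_sq (1 : D)
      rw [hin, map_one, star_one, one_mul, hτ.map_one] at h1
      exact h1.symm
    rw [one_pow]
    exact_mod_cast h
  · intro x a a' y b b'
    ext v
    refine Completion.induction_on v (isClosed_eq (by fun_prop) (by fun_prop)) fun v => ?_
    rw [mul_apply_eq_comp, mul_apply_eq_comp, hl.extend_coe, hr.extend_coe, hr.extend_coe,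
      hl.extend_coe]
    refine completion_coe_eq_of_inner_eq fun u => ?_
    rw [hin, hin, hlv, hrv, hrv, hlv, mul_assoc]
  · intro x y a a' b b'
    rw [mul_apply_eq_comp, hr.extend_coe, hl.extend_coe, Completion.inner_coe, hin, hlv, hrv,
      map_one, star_one, one_mul, one_mul]

end GNS

/-! ### Tracial states on finite-dimensional C*-algebras -/

/-- With respect to a faithful trace, a tracial state on a finite-dimensional C*-algebra has a
density of the form `r²`, where `r` is central and self-adjoint. -/
lemma exists_central_sqrt_density {M : Type*} [CStarAlgebra M] [FiniteDimensional ℂ M]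
    (t σ : M →ₗ[ℂ] ℂ) (ht : ∀ b, 0 ≤ t (star b * b)) (htc : ∀ b c, t (b * c) = t (c * b))
    (htf : ∀ b, t (star b * b) = 0 → b = 0) (hts : ∀ b, t (star b) = star (t b))
    (hσ : IsTracialState σ) :
    ∃ r : M, star r = r ∧ (∀ S, Commute r S) ∧ ∀ S, σ S = t (r * r * S) := by
  let B : M →ₗ[ℂ] Module.Dual ℂ M := (LinearMap.mul ℂ M).compr₂ t
  have hB : ∀ a b, B a b = t (a * b) := fun _ _ => rfl
  have hinj : ∀ a b, (∀ S, t (a * S) = t (b * S)) → a = b := fun a b h => by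
    rw [← sub_eq_zero]
    refine htf _ ?_
    rw [htc, sub_mul, map_sub, h, sub_self]
  have hBi : Function.Injective B := fun a b h => hinj a b fun S => by rw [← hB, h, hB]
  -- The pairing `t(a b)` is nondegenerate because `t` is faithful, so a dimension count represents
  -- `σ` by a density.
  obtain ⟨ρ, hρ⟩ := (LinearMap.injective_iff_surjective_of_finrank_eq_finrank
    (Subspace.dual_finrank_eq (K := ℂ) (V := M)).symm).1 hBi σ
  have hρ' : ∀ S, σ S = t (ρ * S) := fun S => by rw [← hρ, hB]
  have hsa : star ρ = ρ := hinj _ _ fun S => by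
    rw [← hρ', ← star_star S, ← star_mul, hts, htc, ← hρ', hσ.map_star]
    simp only [star_star]
  have hcomm : ∀ S, Commute ρ S := fun S => hinj _ _ fun T => by
    rw [mul_assoc, ← hρ', hσ.map_mul_comm, hρ', ← mul_assoc, htc, mul_assoc]
  let _ : PartialOrder M := CStarAlgebra.spectralOrder M
  have _ : StarOrderedRing M := CStarAlgebra.spectralOrderedRing M
  -- Positivity of `σ` at the negative part: `0 ≤ σ(ρ⁻) = t(ρ ρ⁻) = -t((ρ⁻)²) ≤ 0`, and `t` is
  -- faithful.
  have hneg : ρ⁻ = 0 := by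
    obtain ⟨s, hs⟩ := CStarAlgebra.nonneg_iff_eq_star_mul_self.1 (CFC.negPart_nonneg ρ)
    have h1 : 0 ≤ σ ρ⁻ := by
      rw [hs]
      exact hσ.nonneg s
    have h2 : star ρ⁻ = ρ⁻ := (CFC.negPart_nonneg ρ).isSelfAdjoint.star_eq
    have h3 : ρ * ρ⁻ = -(star ρ⁻ * ρ⁻) := by
      rw [h2]
      have h4 : (ρ⁺ - ρ⁻) * ρ⁻ = -(ρ⁻ * ρ⁻) := by
        rw [sub_mul, CFC.posPart_mul_negPart, zero_sub]
      rwa [CFC.posPart_sub_negPart ρ hsa] at h4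
    rw [hρ', h3, map_neg] at h1
    exact htf _ (le_antisymm (neg_nonneg.1 h1) (ht _))
  have hpos : 0 ≤ ρ := by
    rw [← CFC.posPart_sub_negPart ρ hsa, hneg, sub_zero]
    exact CFC.posPart_nonneg ρ
  refine ⟨CFC.sqrt ρ, (CFC.sqrt_nonneg ρ).isSelfAdjoint.star_eq, fun S => ?_, fun S => ?_⟩
  · exact ((hcomm S).cfcₙ_nnreal _)
  · rw [CFC.sqrt_mul_sqrt_self ρ, hρ']

/-! ### Transposed operators -/

section Transpose

variable {H : Type u} [NormedAddCommGroup H] [InnerProductSpace ℂ H]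
  {ι : Type*} [Fintype ι] (b : OrthonormalBasis ι ℂ H)

lemma ext_inner_orthonormalBasis {S T : H →L[ℂ] H}
    (h : ∀ i j, inner ℂ (b i) (S (b j)) = inner ℂ (b i) (T (b j))) : S = T := by
  have h1 : (S : H →ₗ[ℂ] H) = T := b.toBasis.ext fun j => by
    rw [OrthonormalBasis.coe_toBasis, ContinuousLinearMap.coe_coe, ContinuousLinearMap.coe_coe,
      ← b.sum_repr' (S (b j)), ← b.sum_repr' (T (b j))]
    simp only [h]
  exact ContinuousLinearMap.coe_injective h1

lemma inner_mul_apply (S T : H →L[ℂ] H) (u v : H) :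
    inner ℂ u ((S * T) v) = ∑ k, inner ℂ u (S (b k)) * inner ℂ (b k) (T v) := by
  rw [mul_apply_eq_comp]
  conv_lhs => rw [← b.sum_repr' (T v)]
  rw [map_sum, inner_sum]
  refine Finset.sum_congr rfl fun k _ => ?_
  rw [map_smul, inner_smul_right, mul_comm]

lemma trace_eq_sum_inner_apply (T : H →L[ℂ] H) :
    LinearMap.trace ℂ H (T : H →ₗ[ℂ] H) = ∑ i, inner ℂ (b i) (T (b i)) :=
  LinearMap.trace_eq_sum_inner _ b

variable [FiniteDimensional ℂ H] [DecidableEq ι]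

/-- The transpose of an operator with respect to an orthonormal basis. -/
def transposeOp (T : H →L[ℂ] H) : H →L[ℂ] H :=
  LinearMap.toContinuousLinearMap ((LinearMap.toMatrixOrthonormal b).symm
    (LinearMap.toMatrixOrthonormal b (T : H →ₗ[ℂ] H))ᵀ)

lemma inner_transposeOp (T : H →L[ℂ] H) (i j : ι) :
    inner ℂ (b i) (transposeOp b T (b j)) = inner ℂ (b j) (T (b i)) := by
  have h := LinearMap.toMatrixOrthonormal_apply_apply b
    ((transposeOp b T : H →L[ℂ] H) : H →ₗ[ℂ] H) i j
  refine h.symm.trans ?_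
  have h2 : ((transposeOp b T : H →L[ℂ] H) : H →ₗ[ℂ] H) = (LinearMap.toMatrixOrthonormal b).symm
    (LinearMap.toMatrixOrthonormal b (T : H →ₗ[ℂ] H))ᵀ := rfl
  rw [h2, StarAlgEquiv.apply_symm_apply, Matrix.transpose_apply,
    LinearMap.toMatrixOrthonormal_apply_apply]
  rfl

lemma transposeOp_mul (S T : H →L[ℂ] H) :
    transposeOp b (S * T) = transposeOp b T * transposeOp b S := by
  refine ext_inner_orthonormalBasis b fun i j => ?_
  rw [inner_transposeOp, inner_mul_apply b, inner_mul_apply b]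
  refine Finset.sum_congr rfl fun k _ => ?_
  rw [inner_transposeOp, inner_transposeOp, mul_comm]

lemma transposeOp_one : transposeOp b 1 = 1 := by
  refine ext_inner_orthonormalBasis b fun i j => ?_
  rw [inner_transposeOp, one_apply_eq_self, one_apply_eq_self, b.inner_eq_ite, b.inner_eq_ite]
  simp only [eq_comm]

lemma transposeOp_sum {A : Type*} (s : Finset A) (T : A → (H →L[ℂ] H)) :
    transposeOp b (∑ a ∈ s, T a) = ∑ a ∈ s, transposeOp b (T a) := by
  refine ext_inner_orthonormalBasis b fun i j => ?_
  simp only [inner_transposeOp, _root_.sum_apply, inner_sum]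

lemma star_transposeOp (T : H →L[ℂ] H) : star (transposeOp b T) = transposeOp b (star T) := by
  refine ext_inner_orthonormalBasis b fun i j => ?_
  rw [inner_transposeOp, ContinuousLinearMap.star_eq_adjoint, ContinuousLinearMap.star_eq_adjoint,
    ContinuousLinearMap.adjoint_inner_right, ContinuousLinearMap.adjoint_inner_right,
    ← inner_conj_symm, inner_transposeOp, inner_conj_symm]

/-- The vector of `H ⊗ H` corresponding to the operator `r`. -/
def operatorVector (r : H →L[ℂ] H) : H ⊗[ℂ] H := ∑ i, r (b i) ⊗ₜ[ℂ] b i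

/-- The transpose swaps the basis indices on the second leg, so the left side is `∑_{i,j} ⟨b_i, r S
r b_j⟩ ⟨b_j, T b_i⟩`, which is a trace. -/
lemma inner_operatorVector {r : H →L[ℂ] H} (hr : star r = r) (S T : H →L[ℂ] H) :
    inner ℂ (operatorVector b r) (TensorProduct.map (S : H →ₗ[ℂ] H)
      (transposeOp b T : H →ₗ[ℂ] H) (operatorVector b r)) =
      LinearMap.trace ℂ H ((r * S * r * T : H →L[ℂ] H) : H →ₗ[ℂ] H) := by
  unfold operatorVector
  rw [trace_eq_sum_inner_apply b]
  have hr' : ∀ u v, inner ℂ (r u) v = inner ℂ u (r v) := fun u v => by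
    rw [← ContinuousLinearMap.adjoint_inner_left, ← ContinuousLinearMap.star_eq_adjoint, hr]
  simp only [map_sum, TensorProduct.map_tmul, sum_inner, inner_sum, TensorProduct.inner_tmul]
  rw [Finset.sum_comm]
  refine Finset.sum_congr rfl fun i _ => ?_
  rw [inner_mul_apply b]
  refine Finset.sum_congr rfl fun j _ => ?_
  rw [ContinuousLinearMap.coe_coe, ContinuousLinearMap.coe_coe, inner_transposeOp, hr']
  rfl

end Transpose

/-! ### Quantum strategies -/

section Quantum

variable {X A : Type u} [Fintype A] [DecidableEq A]

section OperatorTrace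

variable {H : Type u} [NormedAddCommGroup H] [InnerProductSpace ℂ H]

/-- The trace of bounded operators on a finite-dimensional Hilbert space. -/
def operatorTrace (H : Type u) [NormedAddCommGroup H] [InnerProductSpace ℂ H] :
    (H →L[ℂ] H) →ₗ[ℂ] ℂ :=
  LinearMap.trace ℂ H ∘ₗ ContinuousLinearMap.coeLM ℂ

lemma operatorTrace_apply (S : H →L[ℂ] H) :
    operatorTrace H S = LinearMap.trace ℂ H (S : H →ₗ[ℂ] H) := rfl

lemma operatorTrace_mul_comm (S T : H →L[ℂ] H) :
    operatorTrace H (S * T) = operatorTrace H (T * S) :=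
  LinearMap.trace_mul_comm ℂ (S : H →ₗ[ℂ] H) (T : H →ₗ[ℂ] H)

variable [CompleteSpace H] [FiniteDimensional ℂ H]

lemma operatorTrace_star_mul_self (S : H →L[ℂ] H) : operatorTrace H (star S * S) =
    ((∑ i, ‖S (stdOrthonormalBasis ℂ H i)‖ ^ 2 : ℝ) : ℂ) := by
  rw [operatorTrace_apply, trace_eq_sum_inner_apply (stdOrthonormalBasis ℂ H), Complex.ofReal_sum]
  refine Finset.sum_congr rfl fun i _ => ?_
  rw [← inner_self_eq_ofReal_norm_sq, mul_apply_eq_comp, ContinuousLinearMap.star_eq_adjoint,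
    ContinuousLinearMap.adjoint_inner_right]

lemma operatorTrace_star_mul_self_nonneg (S : H →L[ℂ] H) :
    0 ≤ operatorTrace H (star S * S) := by
  rw [operatorTrace_star_mul_self]
  exact Complex.zero_le_real.2 (Finset.sum_nonneg fun i _ => sq_nonneg _)

lemma eq_zero_of_operatorTrace_star_mul_self {S : H →L[ℂ] H}
    (hS : operatorTrace H (star S * S) = 0) : S = 0 := by
  rw [operatorTrace_star_mul_self, Complex.ofReal_eq_zero, Finset.sum_eq_zero_iff_of_nonneg
    fun i _ => sq_nonneg _] at hS
  refine ContinuousLinearMap.coe_injective ((stdOrthonormalBasis ℂ H).toBasis.ext fun i => ?_)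
  simpa using hS i (Finset.mem_univ i)

lemma operatorTrace_star (S : H →L[ℂ] H) : operatorTrace H (star S) = star (operatorTrace H S) := by
  rw [operatorTrace_apply, operatorTrace_apply, trace_eq_sum_inner_apply (stdOrthonormalBasis ℂ H),
    trace_eq_sum_inner_apply (stdOrthonormalBasis ℂ H), star_sum]
  refine Finset.sum_congr rfl fun i _ => ?_
  rw [RCLike.star_def, inner_conj_symm, ContinuousLinearMap.star_eq_adjoint,
    ContinuousLinearMap.adjoint_inner_right]

lemma exists_operator_density (M : StarSubalgebra ℂ (H →L[ℂ] H))
    {σ : M →ₗ[ℂ] ℂ} (hσ : IsTracialState σ) :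
    ∃ r : H →L[ℂ] H, star r = r ∧ (∀ S ∈ M, Commute r S) ∧
      ∀ S : M, σ S = operatorTrace H (r * r * S.1) := by
  have hfd : FiniteDimensional ℂ M :=
    inferInstanceAs (FiniteDimensional ℂ (Subalgebra.toSubmodule M.toSubalgebra))
  -- Closedness makes `M` a C*-algebra in its own right; the operator trace restricted to it is the
  -- faithful reference trace.
  have hclosed : IsClosed (M : Set (H →L[ℂ] H)) :=
    (Subalgebra.toSubmodule M.toSubalgebra).closed_of_finiteDimensional
  let t : M →ₗ[ℂ] ℂ := operatorTrace H ∘ₗ (Subalgebra.toSubmodule M.toSubalgebra).subtype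
  obtain ⟨r, hr, hrc, hrσ⟩ := exists_central_sqrt_density t σ
    (fun S => operatorTrace_star_mul_self_nonneg S.1)
    (fun S T => operatorTrace_mul_comm S.1 T.1)
    (fun S hS => Subtype.ext (eq_zero_of_operatorTrace_star_mul_self hS))
    (fun S => operatorTrace_star S.1) hσ
  exact ⟨r.1, congrArg Subtype.val hr, fun S hS => congrArg Subtype.val (hrc ⟨S, hS⟩), hrσ⟩

end OperatorTrace

/-- The finite-dimensional counterpart of left and right multiplication: transposition reverses
products, so the second family is the transpose of the representation with its indices swapped. -/
theorem exists_tensor_of_factorsFinDim {τ : FreeProd X A →ₗ[ℂ] ℂ} (hτ : FactorsFinDim τ) :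
    ∃ (H : Type u) (_ : NormedAddCommGroup H) (_ : InnerProductSpace ℂ H)
      (_ : FiniteDimensional ℂ H) (ξ : H ⊗[ℂ] H) (E F : X → A → A → (H →L[ℂ] H)),
      ‖ξ‖ = 1 ∧ IsStochastic E ∧ IsStochastic F ∧
      ∀ x y a a' b b', inner ℂ ξ (TensorProduct.map (E x a a' : H →ₗ[ℂ] H)
        (F y b b' : H →ₗ[ℂ] H) ξ) = τ (gen x a a' * gen y b' b) := by
  obtain ⟨H, _, _, _, _, π, σ, hσ, hτσ⟩ := hτ
  let o := stdOrthonormalBasis ℂ H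
  obtain ⟨r, hr, hrc, hrσ⟩ := exists_operator_density π.range hσ
  have hval : ∀ b c, inner ℂ (operatorVector o r) (TensorProduct.map (π b : H →ₗ[ℂ] H)
      (transposeOp o (π c) : H →ₗ[ℂ] H) (operatorVector o r)) = τ (b * c) := fun b c => by
    -- Since `r` commutes with `π b`, the product `r π(b) r π(c)` becomes `r² π(b c)`, whose trace
    -- is `τ(b c)`.
    rw [inner_operatorVector o hr, hτσ, hrσ, operatorTrace_apply, mul_assoc r (π b) r, ← (hrc (π b) ⟨b, rfl⟩).eq]
    congr 2
    rw [← mul_assoc, mul_assoc (r * r)]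
    exact congrArg (r * r * ·) (map_mul π b c).symm
  have hτ1 : τ 1 = 1 := by
    rw [hτσ, ← hσ.map_one]
    exact congrArg σ (Subtype.ext (map_one π))
  refine ⟨H, inferInstance, inferInstance, inferInstance, operatorVector o r,
    fun x a a' => π (gen x a a'), fun y b b' => transposeOp o (π (gen y b' b)), ?_, ?_, ?_,
    fun x y a a' b b' => hval _ _⟩
  · have h := hval 1 1
    have h2 : TensorProduct.map ((1 : H →L[ℂ] H) : H →ₗ[ℂ] H) ((1 : H →L[ℂ] H) : H →ₗ[ℂ] H) =
        LinearMap.id := TensorProduct.map_id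
    rw [mul_one, hτ1, map_one, transposeOp_one, h2, LinearMap.id_apply] at h
    have h3 := (inner_self_eq_ofReal_norm_sq (operatorVector o r)).symm.trans h
    rw [← sq_eq_sq₀ (norm_nonneg _) zero_le_one, one_pow]
    exact_mod_cast h3
  · refine .of_matrixUnits (fun x a b c => ?_) (fun x a b u w => ?_) fun x => ?_
    · rw [← map_mul, gen_mul_gen, if_pos rfl]
    · rw [← star_gen x a b, map_star, ContinuousLinearMap.star_eq_adjoint,
        ContinuousLinearMap.adjoint_inner_left]
    · rw [← map_sum, sum_gen, map_one]
  · refine .of_matrixUnits (fun x a b c => ?_) (fun x a b u w => ?_) fun x => ?_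
    · rw [← transposeOp_mul, ← map_mul, gen_mul_gen, if_pos rfl]
    · rw [← star_gen x b a, map_star, ← star_transposeOp, ContinuousLinearMap.star_eq_adjoint,
        ContinuousLinearMap.adjoint_inner_left]
    · rw [← transposeOp_sum, ← map_sum, sum_gen, map_one, transposeOp_one]

variable {H K : Type u} [NormedAddCommGroup H] [InnerProductSpace ℂ H]
  [NormedAddCommGroup K] [InnerProductSpace ℂ K]

omit [Fintype A] [DecidableEq A] in
lemma exists_eq_sum_tmul {ι : Type*} [Fintype ι] (k : OrthonormalBasis ι ℂ K) (v : H ⊗[ℂ] K) :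
    ∃ u : ι → H, v = ∑ j, u j ⊗ₜ[ℂ] k j := by
  induction v using TensorProduct.induction_on with
  | zero => exact ⟨0, by simp⟩
  | tmul h w =>
    refine ⟨fun j => inner ℂ (k j) w • h, ?_⟩
    conv_lhs => rw [← k.sum_repr' w]
    simp only [TensorProduct.tmul_sum, TensorProduct.smul_tmul]
  | add v w hv hw =>
    obtain ⟨u, rfl⟩ := hv
    obtain ⟨u', rfl⟩ := hw
    exact ⟨u + u', by simp [TensorProduct.add_tmul, Finset.sum_add_distrib]⟩

omit [Fintype A] [DecidableEq A] in
lemma rTensor_mul_lTensor_apply (S : H →L[ℂ] H) (T : K →L[ℂ] K) (v : H ⊗[ℂ] K) :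
    (S.rTensor K * T.lTensor H) v = TensorProduct.map (S : H →ₗ[ℂ] H) (T : K →ₗ[ℂ] K) v := by
  induction v using TensorProduct.induction_on with
  | zero => rw [map_zero, map_zero]
  | tmul h w => rfl
  | add v w hv hw => rw [map_add, map_add, hv, hw]

omit [Fintype A] [DecidableEq A] in
lemma lTensor_mul_rTensor_apply (S : H →L[ℂ] H) (T : K →L[ℂ] K) (v : H ⊗[ℂ] K) :
    (T.lTensor H * S.rTensor K) v = TensorProduct.map (S : H →ₗ[ℂ] H) (T : K →ₗ[ℂ] K) v := by
  induction v using TensorProduct.induction_on with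
  | zero => rw [map_zero, map_zero]
  | tmul h w => rfl
  | add v w hv hw => rw [map_add, map_add, hv, hw]

omit [DecidableEq A] in
-- An orthonormal basis of `K` splits `H ⊗ K` into orthogonal copies of `H`, and the quadratic form
-- of `E ⊗ 1` is the sum of those of `E` on the copies.
lemma IsStochastic.rTensor {E : X → A → A → (H →L[ℂ] H)} (hE : IsStochastic E)
    [FiniteDimensional ℂ K] : IsStochastic fun x a a' => (E x a a').rTensor K := by
  refine ⟨fun x v => ?_, fun x => ?_⟩
  · let k := stdOrthonormalBasis ℂ K
    choose u hu using fun a => exists_eq_sum_tmul k (v a)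
    have h : ∀ a a', inner ℂ (v a) ((E x a a').rTensor K (v a')) =
        ∑ j, inner ℂ (u a j) (E x a a' (u a' j)) := fun a a' => by
      rw [hu a, hu a', map_sum, sum_inner]
      refine Finset.sum_congr rfl fun j _ => ?_
      rw [inner_sum, Finset.sum_eq_single j]
      · rw [ContinuousLinearMap.rTensor_tmul, TensorProduct.inner_tmul, k.inner_eq_ite, if_pos rfl,
          mul_one]
      · intro i _ hi
        rw [ContinuousLinearMap.rTensor_tmul, TensorProduct.inner_tmul, k.inner_eq_ite,
          if_neg hi.symm, mul_zero]
      · simp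
    simp only [h]
    simp only [Finset.sum_comm (s := (Finset.univ : Finset A))
      (t := (Finset.univ : Finset (Fin (Module.finrank ℂ K))))]
    exact Finset.sum_nonneg fun j _ => hE.1 x fun a => u a j
  · ext v
    have h : ∀ u, ∑ a, E x a a u = u := fun u => by
      rw [← _root_.sum_apply, hE.2 x, one_apply_eq_self]
    rw [_root_.sum_apply, one_apply_eq_self]
    induction v using TensorProduct.induction_on with
    | zero => simp
    | tmul u w => simp only [ContinuousLinearMap.rTensor_tmul, ← TensorProduct.sum_tmul, h]
    | add v w hv hw => simp only [map_add, Finset.sum_add_distrib, hv, hw]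

omit [DecidableEq A] in
lemma IsStochastic.lTensor {F : X → A → A → (K →L[ℂ] K)} (hF : IsStochastic F)
    [FiniteDimensional ℂ H] : IsStochastic fun x a a' => (F x a a').lTensor H := by
  have hc : ∀ x a a' (v : H ⊗[ℂ] K), TensorProduct.comm ℂ H K ((F x a a').lTensor H v) =
      (F x a a').rTensor H (TensorProduct.comm ℂ H K v) := fun x a a' v => by
    induction v using TensorProduct.induction_on with
    | zero => simp
    | tmul h w => rfl
    | add v w hv hw => simp only [map_add, hv, hw]
  have h := hF.rTensor (K := H)
  refine ⟨fun x v => ?_, fun x => ?_⟩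
  · have h1 := h.1 x fun a => TensorProduct.comm ℂ H K (v a)
    simpa only [← hc, TensorProduct.inner_comm_comm] using h1
  · ext v
    have h1 := congrArg (fun T : K ⊗[ℂ] H →L[ℂ] K ⊗[ℂ] H => T (TensorProduct.comm ℂ H K v)) (h.2 x)
    simp only [_root_.sum_apply, ← hc, one_apply_eq_self, ← map_sum] at h1
    simpa using (TensorProduct.comm ℂ H K).injective h1

/-- The same vector functional serves on the image of `π`; every element there is some `π b`, so the
tracial state axioms descend. -/
lemma factorsFinDim_vectorFunctional {K : Type u} [NormedAddCommGroup K] [InnerProductSpace ℂ K]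
    [CompleteSpace K] [FiniteDimensional ℂ K] (π : FreeProd X A →⋆ₐ[ℂ] (K →L[ℂ] K)) (η : K)
    (hτ : IsTracialState (vectorFunctional η ∘ₗ π.toAlgHom.toLinearMap)) :
    FactorsFinDim (vectorFunctional η ∘ₗ π.toAlgHom.toLinearMap) := by
  refine ⟨K, inferInstance, inferInstance, inferInstance, inferInstance, π,
    vectorFunctional η ∘ₗ π.range.subtype.toLinearMap, ⟨?_, ?_, ?_⟩, fun _ => rfl⟩
  · rintro ⟨_, b, rfl⟩
    have h := hτ.nonneg b
    rw [LinearMap.comp_apply] at h ⊢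
    convert h using 2
    exact (map_mul π (star b) b).trans (congrArg (· * π b) (map_star π b)) |>.symm
  · have h := hτ.map_one
    rw [LinearMap.comp_apply] at h ⊢
    convert h using 2
    exact (map_one π).symm
  · rintro ⟨_, b, rfl⟩ ⟨_, c, rfl⟩
    have h := hτ.map_mul_comm b c
    rw [LinearMap.comp_apply, LinearMap.comp_apply] at h ⊢
    convert h using 2
    · exact (map_mul π b c).symm
    · exact (map_mul π c b).symm

end Quantum

/-! ### Perfect strategies yield traces, and the final equivalences. -/

section Main

variable {X A : Type u} [Fintype X] [DecidableEq X] [Fintype A] [DecidableEq A]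

/-- Serves both cases at once: the trace lives on a subspace of `H`, so finite dimension is
inherited. -/
theorem exists_tracial_of_isPerfect {φ : Game X X A A} (hφ : φ.IsConcurrent)
    {Γ : Diag (X × X) →ₗ[ℂ] Matrix (A × A) (A × A) ℂ} (hΓ : IsCQNS Γ) (hp : IsPerfect φ Γ)
    {H : Type u} [NormedAddCommGroup H] [InnerProductSpace ℂ H] [CompleteSpace H] {ξ : H}
    (hξ : ‖ξ‖ = 1) {E F : X → A → A → (H →L[ℂ] H)} (hE : IsStochastic E) (hF : IsStochastic F)
    (hcomm : ∀ x a a' y b b', E x a a' * F y b b' = F y b b' * E x a a')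
    (h : ∀ x y a a' b b', Γ (diagKron (diagUnit x) (diagUnit y)) (a, b) (a', b') =
      inner ℂ ξ ((E x a a' * F y b b') ξ)) :
    ∃ τ : FreeProd X A →ₗ[ℂ] ℂ, IsTracialState τ ∧ IsGivenBy Γ τ ∧
      (FiniteDimensional ℂ H → FactorsFinDim τ) := by
  have hs := sum_eq_of_isPerfect hφ hΓ.1.2 hp
  simp only [h] at hs
  have hs' := congrArg Complex.re hs
  simp only [Complex.re_sum] at hs'
  have hs2 : (Fintype.card X * Fintype.card A : ℝ) ≤
      ∑ x : X, ∑ a : A, ∑ a' : A, (inner ℂ ξ ((E x a a' * F x a a') ξ)).re := by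
    rw [hs']
    norm_cast
  obtain ⟨K, hK, π, η, hτ, hval⟩ := exists_tracial_vectorFunctional hξ hE hF hcomm
    (hE.eq_of_sum_le hF hξ hs2)
  exact ⟨vectorFunctional η ∘ₗ π.toAlgHom.toLinearMap, hτ,
    fun x y a a' b b' => (h x y a a' b b').trans (hval x y a a' b b').symm,
    fun _ => factorsFinDim_vectorFunctional π η hτ⟩

end Main

end

end CqGame

theorem corollary3p10 {X A : Type u} [Fintype X] [DecidableEq X] [Fintype A] [DecidableEq A]
    (φ : CqGame.Game X X A A) (hφ : φ.IsConcurrent)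
    (Γ : CqGame.Diag (X × X) →ₗ[ℂ] Matrix (A × A) (A × A) ℂ) (hΓ : CqGame.IsCQNS Γ) :
    ((CqGame.IsQuantumCommuting Γ ∧ CqGame.IsPerfect φ Γ) ↔
      ∃ τ : CqGame.FreeProd X A →ₗ[ℂ] ℂ, CqGame.IsTracialState τ ∧
        CqGame.IsGivenBy Γ τ ∧ CqGame.Annihilates τ φ) ∧
    ((CqGame.IsQuantum Γ ∧ CqGame.IsPerfect φ Γ) ↔
      ∃ τ : CqGame.FreeProd X A →ₗ[ℂ] ℂ, CqGame.IsTracialState τ ∧ CqGame.FactorsFinDim τ ∧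
        CqGame.IsGivenBy Γ τ ∧ CqGame.Annihilates τ φ) := by
  refine ⟨⟨?_, ?_⟩, ⟨?_, ?_⟩⟩
  · rintro ⟨⟨H, _, _, _, ξ, E, F, hξ, hE, hF, hcomm, h⟩, hp⟩
    obtain ⟨τ, hτ, hg, -⟩ :=
      CqGame.exists_tracial_of_isPerfect hφ hΓ hp hξ hE hF hcomm h
    exact ⟨τ, hτ, hg, (CqGame.isPerfect_iff_annihilates φ hg).1 hp⟩
  · rintro ⟨τ, hτ, hg, ha⟩
    obtain ⟨H, i1, i2, i3, ξ, E, F, hξ, hE, hF, hcomm, h⟩ :=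
      CqGame.exists_commuting_of_tracialState hτ
    exact ⟨⟨H, i1, i2, i3, ξ, E, F, hξ, hE, hF, hcomm, fun x y a a' b b' =>
      (hg x y a a' b b').trans (h x y a a' b b').symm⟩,
      (CqGame.isPerfect_iff_annihilates φ hg).2 ha⟩
  · rintro ⟨⟨H, K, _, _, _, _, _, _, ξ, E, F, hξ, hE, hF, h⟩, hp⟩
    -- The operators `E ⊗ 1` and `1 ⊗ F` turn the tensor strategy into a commuting one on the
    -- finite-dimensional space `H ⊗ K`.
    have : CompleteSpace (H ⊗[ℂ] K) := FiniteDimensional.complete ℂ _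
    obtain ⟨τ, hτ, hg, hfd⟩ :=
      CqGame.exists_tracial_of_isPerfect hφ hΓ hp hξ (hE.rTensor (K := K)) (hF.lTensor (H := H))
        (fun x a a' y b b' => ContinuousLinearMap.ext fun v =>
          (CqGame.rTensor_mul_lTensor_apply _ _ v).trans
            (CqGame.lTensor_mul_rTensor_apply _ _ v).symm)
        (fun x y a a' b b' => (h x y a a' b b').trans
          (congrArg _ (CqGame.rTensor_mul_lTensor_apply _ _ ξ).symm))
    exact ⟨τ, hτ, hfd inferInstance, hg, (CqGame.isPerfect_iff_annihilates φ hg).1 hp⟩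
  · rintro ⟨τ, hτ, hfd, hg, ha⟩
    obtain ⟨H, i1, i2, i3, ξ, E, F, hξ, hE, hF, h⟩ := CqGame.exists_tensor_of_factorsFinDim hfd
    exact ⟨⟨H, H, i1, i2, i3, i1, i2, i3, ξ, E, F, hξ, hE, hF, fun x y a a' b b' =>
      (hg x y a a' b b').trans (h x y a a' b b').symm⟩,
      (CqGame.isPerfect_iff_annihilates φ hg).2 ha⟩
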